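/- Let $p\in C^1([0,1];(0,\infty))$, $r\in C^0([0,1];(0,\infty))$, $q\in C^0([0,1];\mathbb R)$, and let $a_1,a_2,b_1,b_2\in\mathbb R$ satisfy $|a_1|+|a_2|>0$ and $b_1^2+b_2^2=1$. For $f\in C^2([0,1];\mathbb R)$ put $$(Af)(z)=-\frac1{r(z)}\,\frac{d}{dz}\Bigl(p(z)\frac{df}{dz}(z)\Bigr)+\frac{q(z)}{r(z)}f(z),$$ and for $\mu\in\mathbb R$ let $$X_\mu=\{x\in C^2([0,1];\mathbb R):\ b_1x(0)+b_2x'(0)=\mu,\ a_1x(1)+a_2x'(1)=0\}$$ (derivatives at end points are one-sided). Let $\lambda_1<\lambda_2<\cdots$ be the increasing sequence of all eigenvalues of the Sturm–Liouville operator $A$ with domain $X_0$, and let $\varphi_n\in X_0$ be an eigenfunction for $\lambda_n$, normalized by $\int_0^1 r(z)\varphi_n(z)^2\,dz=1$. Assume (H) $\lambda_1>0$ and $\displaystyle\sum_{n=1}^\infty\lambda_n^{-1}\max_{0\le z\le1}|\varphi_n(z)|<\infty$. Then for every $d\in C^2([0,\infty);\mathbb R)$ and every $x_0\in X_{d(0)}$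 there is a unique function $x\in C^0([0,\infty)\times[0,1];\mathbb R)\cap C^1((0,\infty)\times[0,1];\mathbb R)$ such that, with $x[t]=x(t,\cdot)$, one has $x[t]\in X_{d(t)}$ for all $t\ge0$, $x(0,z)=x_0(z)$ for all $z\in[0,1]$, and $$\frac{\partial x}{\partial t}(t,z)-\frac1{r(z)}\frac{\partial}{\partial z}\Bigl(p(z)\frac{\partial x}{\partial z}(t,z)\Bigr)+\frac{q(z)}{r(z)}x(t,z)=0\quad\text{for all }(t,z)\in(0,\infty)\times(0,1).$$ -/

import Mathlib

open Set

/-- The coefficients of a regular Sturm-Liouville operator on `[0,1]` with separated boundary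
conditions. Functions on `[0,1]` are represented by functions `ℝ → ℝ`; only their values on `[0,1]`
matter, and derivatives are taken within `[0,1]` (hence one-sided at the end points). -/
structure SturmLiouville where
  p : ℝ → ℝ
  r : ℝ → ℝ
  q : ℝ → ℝ
  a₁ : ℝ
  a₂ : ℝ
  b₁ : ℝ
  b₂ : ℝ
  p_contDiffOn : ContDiffOn ℝ 1 p (Icc 0 1)
  p_pos : ∀ z ∈ Icc (0 : ℝ) 1, 0 < p z
  r_continuousOn : ContinuousOn r (Icc 0 1)
  r_pos : ∀ z ∈ Icc (0 : ℝ) 1, 0 < r z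
  q_continuousOn : ContinuousOn q (Icc 0 1)
  a_ne : 0 < |a₁| + |a₂|
  b_ne : 0 < |b₁| + |b₂|

namespace SturmLiouville

/-- The derivative of a function on `[0,1]`. -/
noncomputable def der (f : ℝ → ℝ) (z : ℝ) : ℝ := derivWithin f (Icc 0 1) z

/-- The differential expression `A f = -(1/r) (p f')' + (q/r) f`. -/
noncomputable def op (S : SturmLiouville) (f : ℝ → ℝ) (z : ℝ) : ℝ :=
  -(1 / S.r z) * der (fun w => S.p w * der f w) z + S.q z / S.r z * f z

/-- The set `X_μ` of all `x ∈ C²([0,1])` with `b₁ x(0) + b₂ x'(0) = μ` and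
`a₁ x(1) + a₂ x'(1) = 0`. The domain of the Sturm-Liouville operator is `X_0`. -/
def X (S : SturmLiouville) (μ : ℝ) : Set (ℝ → ℝ) :=
  {x | ContDiffOn ℝ 2 x (Icc 0 1) ∧
    S.b₁ * x 0 + S.b₂ * der x 0 = μ ∧ S.a₁ * x 1 + S.a₂ * der x 1 = 0}

/-- `f` lies in the domain of the operator and satisfies `A f = l f` (possibly `f = 0`). -/
def SolvesEigenEquation (S : SturmLiouville) (l : ℝ) (f : ℝ → ℝ) : Prop :=
  f ∈ S.X 0 ∧ ∀ z ∈ Icc (0 : ℝ) 1, S.op f z = l * f z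

/-- `l` is an eigenvalue: there is an eigenfunction that does not vanish identically on `[0,1]`. -/
def IsEigenvalue (S : SturmLiouville) (l : ℝ) : Prop :=
  ∃ f : ℝ → ℝ, S.SolvesEigenEquation l f ∧ ∃ z ∈ Icc (0 : ℝ) 1, f z ≠ 0

/-- `lam 0 < lam 1 < …` lists all eigenvalues of the operator in increasing order, and `phi n` is an
eigenfunction for `lam n`, normalized in the weighted space `L²_r([0,1])`. -/
structure IsEigenSequence (S : SturmLiouville) (lam : ℕ → ℝ) (phi : ℕ → ℝ → ℝ) : Prop where
  strictMono : StrictMono lam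
  mem_range_iff : ∀ l : ℝ, l ∈ range lam ↔ S.IsEigenvalue l
  solves : ∀ n, S.SolvesEigenEquation (lam n) (phi n)
  normalized : ∀ n, ∫ z in (0 : ℝ)..1, S.r z * phi n z ^ 2 = 1

/-- Assumption (H): the smallest eigenvalue is positive, and the series of
`λ_n⁻¹ max_{0 ≤ z ≤ 1} |φ_n(z)|` converges. (The index is shifted: it starts at `0`. Normalized
eigenfunctions are unique up to sign on `[0,1]`, so that the choice of `phi` does not matter.) -/
def AssumptionH (S : SturmLiouville) : Prop :=
  ∃ (lam : ℕ → ℝ) (phi : ℕ → ℝ → ℝ), S.IsEigenSequence lam phi ∧ 0 < lam 0 ∧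
    Summable fun n => (lam n)⁻¹ * sSup ((fun z => |phi n z|) '' Icc 0 1)

/-- `x` is a classical solution of `∂x/∂t + A x[t] = 0` on `(0,∞) × (0,1)` with boundary
disturbance `d`, that is, `x[t] ∈ X_{d(t)}` for all `t ≥ 0`, and with initial condition `x₀`;
it belongs to `C⁰([0,∞) × [0,1]) ∩ C¹((0,∞) × [0,1])`. -/
structure IsClassicalSolution (S : SturmLiouville) (d x₀ : ℝ → ℝ) (x : ℝ → ℝ → ℝ) : Prop where
  continuousOn : ContinuousOn (fun tz : ℝ × ℝ => x tz.1 tz.2) (Ici 0 ×ˢ Icc 0 1)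
  contDiffOn : ContDiffOn ℝ 1 (fun tz : ℝ × ℝ => x tz.1 tz.2) (Ioi 0 ×ˢ Icc 0 1)
  mem_X : ∀ t, 0 ≤ t → x t ∈ S.X (d t)
  initial : ∀ z ∈ Icc (0 : ℝ) 1, x 0 z = x₀ z
  pde : ∀ t, 0 < t → ∀ z ∈ Ioo (0 : ℝ) 1, deriv (fun s => x s z) t + S.op (x t) z = 0

end SturmLiouville

/-! Since `0` is not an eigenvalue, the operator A with homogeneous boundary conditions has an
inverse G, the Green operator built from two solutions of the homogeneous equation. G is compact and
symmetric on the weighted `L²` space, its eigenfunctions for nonzero eigenvalues are continuous, and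
Sturm–Liouville eigenvalues are simple. The spectral theorem therefore makes the φ_n complete
(`IsEigenSequence.eq_zero_of_coeff_eq_zero`). The coefficients of G f are O(1/λ_n), so (H) makes the
expansion of G f converge uniformly (`IsEigenSequence.hasSum_coeff`).

Existence: let H solve A H = 0 with boundary values 1 at z = 0 and 0 at z = 1. The ansatz x = d H +
w - d' G H turns the problem into w' + A w = d'' G H with homogeneous boundary conditions and w(0) =
G(A x₀ + d'(0) H). The term d' G H is there because the plain lifting x - d H leaves the forcing -d'
H, whose coefficients need not decay; those of G H are O(1/λ_n). Duhamel's formula for each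
coefficient a_n then gives a_n = O(1/λ_n) on bounded time intervals, and λ_n a_n = O(1/λ_n) on
compact subsets of t > 0. By (H) the series for w, A w and w' converge uniformly in z
(`IsEigenSequence.exists_mildSolution`). Regularity in z comes from w = G(A w), not from
differentiating the series.

Uniqueness: each coefficient of the difference of two solutions satisfies c' = -λ_n c and c(0) = 0,
hence vanishes, and completeness applies. -/

/-! ### Linear initial value problems. -/

/-- Global existence on `[0,1]` for an ordinary differential equation with a globally Lipschitz
right-hand side. -/
theorem exists_hasDerivWithinAt_Icc_of_lipschitzWith {F : Type*} [NormedAddCommGroup F]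
    [NormedSpace ℝ F] [CompleteSpace F] (v : ℝ → F → F) (K : NNReal)
    (hv : Continuous (Function.uncurry v)) (hK : ∀ t, LipschitzWith K (v t)) (x₀ : F) :
    ∃ x : ℝ → F, x 0 = x₀ ∧
      ∀ t ∈ Icc (0 : ℝ) 1, HasDerivWithinAt x (v t (x t)) (Icc 0 1) t := by
  -- Picard iteration on all of `[0,1]` at once: the unknown is w = e^{-ks} x, which is the weighted
  -- sup norm in disguise. Any k > K makes the map contract, with constant K / k.
  set k : ℝ := K + 1 with hk
  have hk0 : 0 < k := by positivity
  let g : C(Icc (0 : ℝ) 1, F) → ℝ → F := fun w s =>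
    v s (Real.exp (k * s) • IccExtend zero_le_one w s)
  have hgc : ∀ w, Continuous (g w) := fun w => by
    have : Continuous (IccExtend (zero_le_one (α := ℝ)) w) := w.continuous.Icc_extend'
    exact hv.comp (by fun_prop : Continuous fun s : ℝ =>
      (s, Real.exp (k * s) • IccExtend (zero_le_one (α := ℝ)) w s))
  have hder : ∀ w t, HasDerivAt (fun z => x₀ + ∫ s in (0 : ℝ)..z, g w s) (g w t) t := fun w t =>
    ((hgc w).integral_hasStrictDerivAt 0 t).hasDerivAt.const_add x₀
  have hint : ∀ w, Continuous fun z => x₀ + ∫ s in (0 : ℝ)..z, g w s := fun w =>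
    continuous_iff_continuousAt.2 fun t => (hder w t).continuousAt
  let Φ : C(Icc (0 : ℝ) 1, F) → C(Icc (0 : ℝ) 1, F) := fun w =>
    ⟨fun z => Real.exp (-(k * z)) • (x₀ + ∫ s in (0 : ℝ)..z, g w s),
      ((by fun_prop : Continuous fun z : ℝ => Real.exp (-(k * z))).smul (hint w)).comp
        continuous_subtype_val⟩
  have hΦ : ContractingWith (K / (K + 1)) Φ := by
    refine ⟨(div_lt_one (by positivity)).2 (lt_add_one K), LipschitzWith.of_dist_le_mul ?_⟩
    intro w w'
    rw [ContinuousMap.dist_le (by positivity)]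
    intro z
    have hz0 : (0 : ℝ) ≤ z := z.2.1
    have hsub : Φ w z - Φ w' z = Real.exp (-(k * z)) • ∫ s in (0 : ℝ)..z, (g w s - g w' s) := by
      rw [intervalIntegral.integral_sub ((hgc w).intervalIntegrable _ _)
        ((hgc w').intervalIntegrable _ _)]
      simp only [Φ, ContinuousMap.coe_mk, ← smul_sub, add_sub_add_left_eq_sub]
    have hb : ∀ s ∈ Ioc (0 : ℝ) z, ‖g w s - g w' s‖ ≤ K * dist w w' * Real.exp (k * s) := by
      intro s hs
      rw [← dist_eq_norm]
      refine ((hK s).dist_le_mul _ _).trans ?_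
      rw [dist_smul₀, Real.norm_of_nonneg (Real.exp_pos _).le, mul_assoc, mul_comm (dist w w')]
      gcongr
      exact ContinuousMap.dist_apply_le_dist _
    have hI : ∫ s in (0 : ℝ)..z, K * dist w w' * Real.exp (k * s)
        ≤ K * dist w w' * (Real.exp (k * z) / k) := by
      rw [intervalIntegral.integral_const_mul]
      gcongr
      rw [intervalIntegral.integral_comp_mul_left _ hk0.ne', integral_exp, smul_eq_mul, mul_zero,
        Real.exp_zero, div_eq_inv_mul]
      gcongr
      linarith
    rw [dist_eq_norm, hsub, norm_smul, Real.norm_of_nonneg (Real.exp_pos _).le]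
    have h3 := (intervalIntegral.norm_integral_le_of_norm_le hz0 (Filter.Eventually.of_forall hb)
      ((by fun_prop : Continuous fun s : ℝ =>
        K * dist w w' * Real.exp (k * s)).intervalIntegrable _ _)).trans hI
    calc _ ≤ Real.exp (-(k * z)) * (K * dist w w' * (Real.exp (k * z) / k)) := by gcongr
      _ = (Real.exp (-(k * z)) * Real.exp (k * z)) * (K / k * dist w w') := by ring
      _ = _ := by
        rw [← Real.exp_add, neg_add_cancel, Real.exp_zero, one_mul]
        simp [hk]
  obtain ⟨w, hw⟩ : ∃ w, Φ w = w := ⟨_, hΦ.fixedPoint_isFixedPt⟩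
  refine ⟨fun z => x₀ + ∫ s in (0 : ℝ)..z, g w s, by simp, fun t ht => ?_⟩
  have hx : Real.exp (k * t) • IccExtend (zero_le_one (α := ℝ)) w t
      = x₀ + ∫ s in (0 : ℝ)..t, g w s := by
    have h : w ⟨t, ht⟩ = Real.exp (-(k * t)) • (x₀ + ∫ s in (0 : ℝ)..t, g w s) := by
      conv_lhs => rw [← hw]
      rfl
    rw [IccExtend_of_mem _ _ ht, h, smul_smul, ← Real.exp_add, add_neg_cancel, Real.exp_zero,
      one_smul]
  have := (hder w t).hasDerivWithinAt (s := Icc 0 1)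
  rwa [show g w t = v t (x₀ + ∫ s in (0 : ℝ)..t, g w s) by rw [← hx]] at this

/-! ### The equation A u = g as a first-order system for u and its flux p u'. -/

namespace SturmLiouville

/-- Real continuous functions on `[0,1]`. -/
abbrev CI := C(Icc (0 : ℝ) 1, ℝ)

/-- The extension of a continuous function on `[0,1]` by constants. -/
noncomputable def ext (f : CI) : ℝ → ℝ := IccExtend zero_le_one f

theorem continuous_ext (f : CI) : Continuous (ext f) := f.continuous.Icc_extend'

theorem ext_apply (f : CI) {z : ℝ} (hz : z ∈ Icc (0 : ℝ) 1) : ext f z = f ⟨z, hz⟩ :=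
  IccExtend_of_mem _ _ hz

theorem ext_coe (f : CI) (z : Icc (0 : ℝ) 1) : ext f z = f z := ext_apply f z.2

theorem abs_ext_le (f : CI) (z : ℝ) : |ext f z| ≤ ‖f‖ := f.norm_coe_le_norm _

/-- The restriction to `[0,1]` of a function that is continuous there. -/
noncomputable def restr (f : ℝ → ℝ) (hf : ContinuousOn f (Icc 0 1)) : CI :=
  ⟨fun z => f z, hf.domRestrict⟩

theorem restr_apply {f : ℝ → ℝ} (hf : ContinuousOn f (Icc 0 1)) (z : Icc (0 : ℝ) 1) :
    restr f hf z = f z := rfl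

theorem ext_restr {f : ℝ → ℝ} (hf : ContinuousOn f (Icc 0 1)) {z : ℝ} (hz : z ∈ Icc (0 : ℝ) 1) :
    ext (restr f hf) z = f z := ext_apply _ hz

variable (S : SturmLiouville)

/-- `u` and its flux `y = p u'` solve `A u = g` on `[0,1]`. -/
def Solves (u y g : ℝ → ℝ) : Prop :=
  ∀ z ∈ Icc (0 : ℝ) 1, HasDerivWithinAt u (y z / S.p z) (Icc 0 1) z ∧
    HasDerivWithinAt y (S.q z * u z - S.r z * g z) (Icc 0 1) z

variable {S} {u y g v w k : ℝ → ℝ}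

theorem Solves.continuousOn (h : S.Solves u y g) : ContinuousOn u (Icc 0 1) :=
  fun z hz => (h z hz).1.continuousWithinAt

theorem Solves.continuousOn_flux (h : S.Solves u y g) : ContinuousOn y (Icc 0 1) :=
  fun z hz => (h z hz).2.continuousWithinAt

theorem Solves.add (h : S.Solves u y g) (h' : S.Solves v w k) :
    S.Solves (fun z => u z + v z) (fun z => y z + w z) (fun z => g z + k z) := fun z hz =>
  ⟨((h z hz).1.add (h' z hz).1).congr_deriv (by ring),
    ((h z hz).2.add (h' z hz).2).congr_deriv (by ring)⟩

theorem Solves.const_mul (c : ℝ) (h : S.Solves u y g) :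
    S.Solves (fun z => c * u z) (fun z => c * y z) (fun z => c * g z) := fun z hz =>
  ⟨((h z hz).1.const_mul c).congr_deriv (by ring), ((h z hz).2.const_mul c).congr_deriv (by ring)⟩

theorem Solves.congr (h : S.Solves u y g) (hu : EqOn v u (Icc 0 1)) (hg : EqOn k g (Icc 0 1)) :
    S.Solves v y k := fun z hz =>
  ⟨(h z hz).1.congr hu (hu hz), by rw [hu hz, hg hz]; exact (h z hz).2⟩

theorem uniqueDiffOn_unit : UniqueDiffOn ℝ (Icc (0 : ℝ) 1) := uniqueDiffOn_Icc_zero_one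

theorem Solves.der_eq (h : S.Solves u y g) {z : ℝ} (hz : z ∈ Icc (0 : ℝ) 1) :
    der u z = y z / S.p z := (h z hz).1.derivWithin (uniqueDiffOn_unit z hz)

theorem der_congr {f f' : ℝ → ℝ} (h : EqOn f f' (Icc 0 1)) : EqOn (der f) (der f') (Icc 0 1) :=
  fun _ hz => derivWithin_congr h (h hz)

theorem Solves.op_eq (h : S.Solves u y g) {z : ℝ} (hz : z ∈ Icc (0 : ℝ) 1) :
    S.op u z = g z := by
  have h1 : EqOn (fun w => S.p w * der u w) y (Icc 0 1) := fun w hw => by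
    simp only [h.der_eq hw]
    field_simp [(S.p_pos w hw).ne']
  have h2 : der y z = S.q z * u z - S.r z * g z := (h z hz).2.derivWithin (uniqueDiffOn_unit z hz)
  rw [op, der_congr h1 hz, h2]
  field_simp [(S.r_pos z hz).ne']
  ring

theorem contDiffOn_two_of_hasDerivWithinAt {f f' : ℝ → ℝ}
    (h : ∀ z ∈ Icc (0 : ℝ) 1, HasDerivWithinAt f (f' z) (Icc 0 1) z)
    (h' : ContDiffOn ℝ 1 f' (Icc 0 1)) : ContDiffOn ℝ 2 f (Icc 0 1) := by
  rw [show (2 : WithTop ℕ∞) = 1 + 1 by norm_num, contDiffOn_succ_iff_derivWithin uniqueDiffOn_unit]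
  exact ⟨fun z hz => (h z hz).differentiableWithinAt, by simp,
    h'.congr fun z hz => (h z hz).derivWithin (uniqueDiffOn_unit z hz)⟩

/-- The flux has a continuous derivative by the equation, so u' = y / p is C¹ because p is. -/
theorem Solves.contDiffOn (h : S.Solves u y g) (hg : ContinuousOn g (Icc 0 1)) :
    ContDiffOn ℝ 2 u (Icc 0 1) := by
  have hy : ContDiffOn ℝ 1 y (Icc 0 1) := by
    rw [contDiffOn_one_iff_derivWithin uniqueDiffOn_unit]
    refine ⟨fun z hz => (h z hz).2.differentiableWithinAt, ?_⟩
    refine ContinuousOn.congr ?_ fun z hz => (h z hz).2.derivWithin (uniqueDiffOn_unit z hz)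
    exact (S.q_continuousOn.mul h.continuousOn).sub (S.r_continuousOn.mul hg)
  exact contDiffOn_two_of_hasDerivWithinAt (fun z hz => (h z hz).1)
    (hy.div S.p_contDiffOn fun z hz => (S.p_pos z hz).ne')

theorem Solves.mem_X {μ : ℝ} (h : S.Solves u y g) (hg : ContinuousOn g (Icc 0 1))
    (h0 : S.b₁ * u 0 + S.b₂ * (y 0 / S.p 0) = μ) (h1 : S.a₁ * u 1 + S.a₂ * (y 1 / S.p 1) = 0) :
    u ∈ S.X μ :=
  ⟨h.contDiffOn hg, by rw [h.der_eq (by simp), h0], by rw [h.der_eq (by simp), h1]⟩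

theorem contDiffOn_der {f : ℝ → ℝ} (hf : ContDiffOn ℝ 2 f (Icc 0 1)) :
    ContDiffOn ℝ 1 (der f) (Icc 0 1) :=
  hf.derivWithin uniqueDiffOn_unit (by norm_num)

theorem contDiffOn_flux {f : ℝ → ℝ} (hf : ContDiffOn ℝ 2 f (Icc 0 1)) :
    ContDiffOn ℝ 1 (fun w => S.p w * der f w) (Icc 0 1) :=
  S.p_contDiffOn.mul (contDiffOn_der hf)

theorem continuousOn_op {f : ℝ → ℝ} (hf : ContDiffOn ℝ 2 f (Icc 0 1)) :
    ContinuousOn (S.op f) (Icc 0 1) := by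
  have hr : ∀ z ∈ Icc (0 : ℝ) 1, S.r z ≠ 0 := fun z hz => (S.r_pos z hz).ne'
  have hy : ContinuousOn (der fun w => S.p w * der f w) (Icc 0 1) :=
    ((contDiffOn_one_iff_derivWithin uniqueDiffOn_unit).1 (contDiffOn_flux hf)).2
  exact ((continuousOn_const.div S.r_continuousOn hr).neg.mul hy).add
    ((S.q_continuousOn.div S.r_continuousOn hr).mul hf.continuousOn)

theorem solves_op {f : ℝ → ℝ} (hf : ContDiffOn ℝ 2 f (Icc 0 1)) :
    S.Solves f (fun w => S.p w * der f w) (S.op f) := by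
  intro z hz
  have hp := (S.p_pos z hz).ne'
  have hr := (S.r_pos z hz).ne'
  refine ⟨?_, ?_⟩
  · have := ((hf.differentiableOn (by norm_num)) z hz).hasDerivWithinAt
    refine this.congr_deriv ?_
    simp only [der]
    field_simp
  · have := (((contDiffOn_flux (S := S) hf).differentiableOn (by norm_num)) z hz).hasDerivWithinAt
    refine this.congr_deriv ?_
    simp only [op]
    rw [show derivWithin (fun w => S.p w * der f w) (Icc 0 1) z
      = der (fun w => S.p w * der f w) z from rfl]
    field_simp
    ring

theorem X_congr {f f' : ℝ → ℝ} {μ : ℝ} (h : EqOn f' f (Icc 0 1)) (hf : f ∈ S.X μ) :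
    f' ∈ S.X μ := by
  have h0 : (0 : ℝ) ∈ Icc (0 : ℝ) 1 := by simp
  have h1 : (1 : ℝ) ∈ Icc (0 : ℝ) 1 := by simp
  exact ⟨hf.1.congr h, by rw [h h0, der_congr h h0]; exact hf.2.1,
    by rw [h h1, der_congr h h1]; exact hf.2.2⟩

theorem op_congr {f f' : ℝ → ℝ} (h : EqOn f' f (Icc 0 1)) : EqOn (S.op f') (S.op f) (Icc 0 1) := by
  intro z hz
  rw [op, op, h hz]
  congr 2
  exact der_congr (fun w hw => by simp only [der_congr h hw]) hz

/-- Lagrange's identity: the derivative of the Wronskian. -/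
theorem Solves.hasDerivWithinAt_wronskian (h : S.Solves u y g) (h' : S.Solves v w k) {z : ℝ}
    (hz : z ∈ Icc (0 : ℝ) 1) :
    HasDerivWithinAt (fun z => u z * w z - v z * y z) (S.r z * (v z * g z - u z * k z))
      (Icc 0 1) z :=
  (((h z hz).1.mul (h' z hz).2).sub ((h' z hz).1.mul (h z hz).2)).congr_deriv (by ring)

/-- The Wronskian of two solutions of the homogeneous equation is constant. -/
theorem Solves.wronskian_eq (h : S.Solves u y fun _ => 0) (h' : S.Solves v w fun _ => 0) {z : ℝ}
    (hz : z ∈ Icc (0 : ℝ) 1) : u z * w z - v z * y z = u 0 * w 0 - v 0 * y 0 := by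
  have := (convex_Icc (0 : ℝ) 1).is_const_of_fderivWithin_eq_zero (𝕜 := ℝ)
    (f := fun z => u z * w z - v z * y z)
    (fun z hz => (h.hasDerivWithinAt_wronskian h' hz).differentiableWithinAt)
    (fun z hz => by
      have := (h.hasDerivWithinAt_wronskian h' hz).congr_deriv (g' := 0) (by simp)
      simpa using this.hasFDerivWithinAt.fderivWithin (uniqueDiffOn_unit z hz))
    hz (by simp : (0 : ℝ) ∈ Icc (0 : ℝ) 1)
  exact this

/-- Green's identity. -/
theorem Solves.integral_eq (h : S.Solves u y g) (h' : S.Solves v w k)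
    (hg : ContinuousOn g (Icc 0 1)) (hk : ContinuousOn k (Icc 0 1)) :
    ∫ z in (0 : ℝ)..1, S.r z * (v z * g z - u z * k z)
      = (u 1 * w 1 - v 1 * y 1) - (u 0 * w 0 - v 0 * y 0) := by
  have hc : ContinuousOn (fun z => u z * w z - v z * y z) (Icc 0 1) :=
    (h.continuousOn.mul h'.continuousOn_flux).sub (h'.continuousOn.mul h.continuousOn_flux)
  refine intervalIntegral.integral_eq_sub_of_hasDerivAt_of_le zero_le_one hc (fun z hz =>
    (h.hasDerivWithinAt_wronskian h' (Ioo_subset_Icc_self hz)).hasDerivAt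
      (Icc_mem_nhds hz.1 hz.2)) ?_
  refine ContinuousOn.intervalIntegrable ?_
  rw [uIcc_of_le zero_le_one]
  exact S.r_continuousOn.mul ((h'.continuousOn.mul hg).sub (h.continuousOn.mul hk))

end SturmLiouville

/-! ### Compactness of integral operators. -/

/-- The operator `f ↦ (x ↦ ⟪κ x, f⟫)` from an inner product space to continuous functions. -/
noncomputable def innerOperator {X H : Type*} [TopologicalSpace X] [CompactSpace X]
    [NormedAddCommGroup H] [InnerProductSpace ℝ H] (κ : C(X, H)) : H →L[ℝ] C(X, ℝ) :=
  LinearMap.mkContinuous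
    { toFun := fun f => ⟨fun x => inner ℝ (κ x) f, by fun_prop⟩
      map_add' := fun f g => by ext x; simp [inner_add_right]
      map_smul' := fun c f => by ext x; simp [inner_smul_right] }
    ‖κ‖ fun f => by
      refine (ContinuousMap.norm_le _ (by positivity)).2 fun x => ?_
      exact (norm_inner_le_norm _ _).trans (by gcongr; exact κ.norm_coe_le_norm x)

theorem innerOperator_apply {X H : Type*} [TopologicalSpace X] [CompactSpace X]
    [NormedAddCommGroup H] [InnerProductSpace ℝ H] (κ : C(X, H)) (f : H) (x : X) :
    innerOperator κ f x = inner ℝ (κ x) f := rfl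

/-- By Cauchy–Schwarz the images of the unit ball are bounded by ‖κ‖ and inherit the modulus of
continuity of κ, so Arzelà–Ascoli applies. -/
theorem isCompactOperator_innerOperator {X H : Type*} [TopologicalSpace X] [CompactSpace X]
    [NormedAddCommGroup H] [InnerProductSpace ℝ H] (κ : C(X, H)) :
    IsCompactOperator (innerOperator κ) := by
  let e := ContinuousMap.linearIsometryBoundedOfCompact X ℝ ℝ
  let J : H →L[ℝ] BoundedContinuousFunction X ℝ :=
    (e.toContinuousLinearEquiv : C(X, ℝ) →L[ℝ] BoundedContinuousFunction X ℝ).comp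
      (innerOperator κ)
  have hJ : IsCompactOperator J := by
    refine (isCompactOperator_iff_isCompact_closure_image_ball J.toLinearMap one_pos).2 ?_
    refine BoundedContinuousFunction.arzela_ascoli (Metric.closedBall (0 : ℝ) ‖κ‖)
      (isCompact_closedBall _ _) _ ?_ ?_
    · rintro _ x ⟨f, hf, rfl⟩
      rw [mem_closedBall_zero_iff]
      calc ‖inner ℝ (κ x) f‖ ≤ ‖κ x‖ * ‖f‖ := norm_inner_le_norm _ _
        _ ≤ ‖κ‖ * 1 := by
          gcongr
          · exact κ.norm_coe_le_norm x
          · exact (mem_ball_zero_iff.1 hf).le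
        _ = ‖κ‖ := mul_one _
    · intro x
      rw [Metric.equicontinuousAt_iff_right]
      intro ε hε
      filter_upwards [Metric.tendsto_nhds.1 (κ.continuous.continuousAt (x := x)) ε hε]
      rintro x' hx' ⟨_, f, hf, rfl⟩
      rw [dist_comm, dist_eq_norm] at hx'
      rw [dist_eq_norm]
      have : inner ℝ (κ x) f - inner ℝ (κ x') f = inner ℝ (κ x - κ x') f :=
        (inner_sub_left _ _ _).symm
      calc ‖inner ℝ (κ x) f - inner ℝ (κ x') f‖ ≤ ‖κ x - κ x'‖ * ‖f‖ := by
            rw [this]; exact norm_inner_le_norm _ _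
        _ ≤ ‖κ x - κ x'‖ * 1 := by gcongr; exact (mem_ball_zero_iff.1 hf).le
        _ < ε := by rwa [mul_one]
  have : (innerOperator κ : H → C(X, ℝ)) =
      (e.symm.toContinuousLinearEquiv : BoundedContinuousFunction X ℝ →L[ℝ] C(X, ℝ)) ∘ J := by
    funext f
    exact (e.symm_apply_apply _).symm
  rw [this]
  exact hJ.clm_comp _

/-! ### Initial and boundary value problems for the homogeneous equation. -/

namespace SturmLiouville

variable {S : SturmLiouville} {u y g v w k : ℝ → ℝ}

theorem p_ne {z : ℝ} (hz : z ∈ Icc (0 : ℝ) 1) : S.p z ≠ 0 := (S.p_pos z hz).ne'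

theorem continuousOn_inv_p : ContinuousOn (fun z => (S.p z)⁻¹) (Icc 0 1) :=
  S.p_contDiffOn.continuousOn.inv₀ fun _ => p_ne

theorem lipschitzWith_field (A B : CI) (t : ℝ) :
    LipschitzWith (‖A‖₊ + ‖B‖₊) fun x : ℝ × ℝ => (ext A t * x.2, ext B t * x.1) := by
  refine LipschitzWith.of_dist_le_mul fun x x' => ?_
  have hA := abs_ext_le A t
  have hB := abs_ext_le B t
  have h1 : |x.1 - x'.1| ≤ dist x x' := le_max_left _ _
  have h2 : |x.2 - x'.2| ≤ dist x x' := le_max_right _ _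
  have h3 : (0 : ℝ) ≤ dist x x' := dist_nonneg
  rw [Prod.dist_eq (x := (ext A t * x.2, ext B t * x.1))]
  push_cast
  simp only [Real.dist_eq, ← mul_sub, abs_mul]
  have hA0 := norm_nonneg A
  have hB0 := norm_nonneg B
  refine max_le ?_ ?_
  · calc _ ≤ ‖A‖ * dist x x' := by gcongr
      _ ≤ _ := by nlinarith
  · calc _ ≤ ‖B‖ * dist x x' := by gcongr
      _ ≤ _ := by nlinarith

theorem hasDerivWithinAt_fst {x : ℝ → ℝ × ℝ} {x' : ℝ × ℝ} {s : Set ℝ} {t : ℝ}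
    (h : HasDerivWithinAt x x' s t) : HasDerivWithinAt (fun z => (x z).1) x'.1 s t := by
  simpa using (HasFDerivWithinAt.fst h.hasFDerivWithinAt).hasDerivWithinAt

theorem hasDerivWithinAt_snd {x : ℝ → ℝ × ℝ} {x' : ℝ × ℝ} {s : Set ℝ} {t : ℝ}
    (h : HasDerivWithinAt x x' s t) : HasDerivWithinAt (fun z => (x z).2) x'.2 s t := by
  simpa using (HasFDerivWithinAt.snd h.hasFDerivWithinAt).hasDerivWithinAt

theorem exists_solves (l α β : ℝ) :
    ∃ u y, S.Solves u y (fun z => l * u z) ∧ u 0 = α ∧ y 0 = β := by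
  have hB : ContinuousOn (fun z => S.q z - l * S.r z) (Icc 0 1) :=
    S.q_continuousOn.sub (continuousOn_const.mul S.r_continuousOn)
  set A := restr _ (continuousOn_inv_p (S := S))
  set B := restr _ hB
  have hA' := continuous_ext A
  have hB' := continuous_ext B
  obtain ⟨x, hx0, hx⟩ := exists_hasDerivWithinAt_Icc_of_lipschitzWith
    (fun t (x : ℝ × ℝ) => (ext A t * x.2, ext B t * x.1)) _
    (by simp only [Function.uncurry_def]; fun_prop) (lipschitzWith_field A B) (α, β)
  refine ⟨fun z => (x z).1, fun z => (x z).2, fun z hz => ⟨?_, ?_⟩, by simp [hx0], by simp [hx0]⟩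
  · refine (hasDerivWithinAt_fst (hx z hz)).congr_deriv ?_
    simp only [A, ext_restr _ hz]
    ring
  · refine (hasDerivWithinAt_snd (hx z hz)).congr_deriv ?_
    simp only [B, ext_restr _ hz]
    ring

theorem Solves.eq_zero {l : ℝ} (h : S.Solves u y (fun z => l * u z)) (hu : u 0 = 0)
    (hy : y 0 = 0) : EqOn u 0 (Icc 0 1) := by
  have hB : ContinuousOn (fun z => S.q z - l * S.r z) (Icc 0 1) :=
    S.q_continuousOn.sub (continuousOn_const.mul S.r_continuousOn)
  set A := restr _ (continuousOn_inv_p (S := S))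
  set B := restr _ hB
  have key := ODE_solution_unique (f := fun z => (u z, y z)) (g := fun _ => (0, 0)) (a := 0)
    (b := 1)
    (lipschitzWith_field A B) (h.continuousOn.prodMk h.continuousOn_flux) (fun z hz => by
      have hz' := Ico_subset_Icc_self hz
      have hm : Icc (0 : ℝ) 1 ∈ nhdsWithin z (Ici z) :=
        Icc_mem_nhdsGE_of_mem hz
      have h1 := ((h z hz').1.prodMk (h z hz').2).mono_of_mem_nhdsWithin hm
      refine h1.congr_deriv ?_
      rw [ext_restr _ hz', ext_restr _ hz']
      ext <;> ring) continuousOn_const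
    (fun z _ => (hasDerivWithinAt_const z (Ici z) ((0 : ℝ), (0 : ℝ))).congr_deriv (by ext <;> simp))
    (by simp [hu, hy])
  exact fun z hz => congrArg Prod.fst (key hz)

/-- Homogeneous boundary conditions, in terms of a function and its flux. -/
def BC (S : SturmLiouville) (u y : ℝ → ℝ) : Prop :=
  S.b₁ * u 0 + S.b₂ * (y 0 / S.p 0) = 0 ∧ S.a₁ * u 1 + S.a₂ * (y 1 / S.p 1) = 0

theorem zero_mem : (0 : ℝ) ∈ Icc (0 : ℝ) 1 := by simp
theorem one_mem : (1 : ℝ) ∈ Icc (0 : ℝ) 1 := by simp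

theorem Solves.solvesEigenEquation {l : ℝ} (h : S.Solves u y (fun z => l * u z)) (hb : S.BC u y) :
    S.SolvesEigenEquation l u :=
  ⟨h.mem_X (continuousOn_const.mul h.continuousOn) hb.1 hb.2, fun _ hz => h.op_eq hz⟩

theorem BC_flux {f : ℝ → ℝ} (hf : f ∈ S.X 0) : S.BC f (fun w => S.p w * der f w) := by
  refine ⟨?_, ?_⟩
  · rw [mul_div_cancel_left₀ _ (p_ne zero_mem)]; exact hf.2.1
  · rw [mul_div_cancel_left₀ _ (p_ne one_mem)]; exact hf.2.2

theorem SolvesEigenEquation.solves {l : ℝ} {f : ℝ → ℝ} (hf : S.SolvesEigenEquation l f) :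
    S.Solves f (fun w => S.p w * der f w) (fun z => l * f z) :=
  (solves_op hf.1.1).congr (fun _ _ => rfl) fun z hz => (hf.2 z hz).symm

theorem Solves.eq_zero_of_not_isEigenvalue {l : ℝ} (hl : ¬ S.IsEigenvalue l)
    (h : S.Solves u y (fun z => l * u z)) (hb : S.BC u y) : EqOn u 0 (Icc 0 1) := by
  intro z hz
  by_contra hne
  exact hl ⟨u, h.solvesEigenEquation hb, z, hz, hne⟩

/-- The flux vanishes where the function does. -/
theorem Solves.flux_eq_zero (h : S.Solves u y g) (hu : EqOn u 0 (Icc 0 1)) :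
    EqOn y 0 (Icc 0 1) := by
  intro z hz
  have h1 := h.der_eq hz
  have h2 : der u z = 0 := by
    rw [der_congr hu hz]
    simp [der]
  rw [h2, eq_comm, div_eq_zero_iff] at h1
  exact h1.resolve_right (p_ne hz)

/-- The boundary data of both functions are orthogonal to the nonzero vector (b₁, b₂) of the plane,
hence parallel, and the Wronskian is their determinant up to the factor p(0). -/
theorem BC.wronskian_zero (h : S.BC u y) (h' : S.BC v w) : u 0 * w 0 - v 0 * y 0 = 0 := by
  have hp := p_ne (S := S) zero_mem
  have h1 := h.1
  have h2 := h'.1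
  have hb := S.b_ne
  field_simp at h1 h2
  by_cases hb1 : S.b₁ = 0
  · have hb2 : S.b₂ ≠ 0 := by rintro h; simp [hb1, h] at hb
    have e1 : y 0 = 0 := by simpa [hb1, hb2] using h1
    have e2 : w 0 = 0 := by simpa [hb1, hb2] using h2
    simp [e1, e2]
  · have : S.b₁ * S.p 0 * (u 0 * w 0 - v 0 * y 0) = 0 := by
      linear_combination w 0 * h1 - y 0 * h2
    simpa [hb1, hp] using this

theorem BC.wronskian_one (h : S.BC u y) (h' : S.BC v w) : u 1 * w 1 - v 1 * y 1 = 0 := by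
  have hp := p_ne (S := S) one_mem
  have h1 := h.2
  have h2 := h'.2
  have hb := S.a_ne
  field_simp at h1 h2
  by_cases hb1 : S.a₁ = 0
  · have hb2 : S.a₂ ≠ 0 := by rintro h; simp [hb1, h] at hb
    have e1 : y 1 = 0 := by simpa [hb1, hb2] using h1
    have e2 : w 1 = 0 := by simpa [hb1, hb2] using h2
    simp [e1, e2]
  · have : S.a₁ * S.p 1 * (u 1 * w 1 - v 1 * y 1) = 0 := by
      linear_combination w 1 * h1 - y 1 * h2
    simpa [hb1, hp] using this

/-- Symmetry of the operator. -/
theorem Solves.integral_eq_zero (h : S.Solves u y g) (h' : S.Solves v w k)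
    (hg : ContinuousOn g (Icc 0 1)) (hk : ContinuousOn k (Icc 0 1)) (hb : S.BC u y)
    (hb' : S.BC v w) : ∫ z in (0 : ℝ)..1, S.r z * (v z * g z - u z * k z) = 0 := by
  rw [h.integral_eq h' hg hk, hb.wronskian_zero hb', hb.wronskian_one hb', sub_zero]

/-- Normalized solutions of the homogeneous equation, the first of which satisfies the boundary
condition at `0`, and the second of which satisfies the boundary condition at `1`. -/
structure IsFundamental (S : SturmLiouville) (u₁ y₁ u₂ y₂ : ℝ → ℝ) : Prop where
  solves₁ : S.Solves u₁ y₁ fun _ => 0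
  solves₂ : S.Solves u₂ y₂ fun _ => 0
  bc₁ : S.b₁ * u₁ 0 + S.b₂ * (y₁ 0 / S.p 0) = 0
  bc₂ : S.a₁ * u₂ 1 + S.a₂ * (y₂ 1 / S.p 1) = 0
  ne : S.b₁ * u₂ 0 + S.b₂ * (y₂ 0 / S.p 0) ≠ 0
  wronskian : ∀ z ∈ Icc (0 : ℝ) 1, u₁ z * y₂ z - u₂ z * y₁ z = 1

theorem exists_solves_zero (α β : ℝ) :
    ∃ u y, S.Solves u y (fun _ => 0) ∧ u 0 = α ∧ y 0 = β := by
  simpa using exists_solves (S := S) 0 α β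

/-- If the solution adapted to the right end also satisfied the left condition, it would vanish, `0`
not being an eigenvalue; its data at 1 would then force a₁ = a₂ = 0. -/
theorem exists_isFundamental (h0 : ¬ S.IsEigenvalue 0) :
    ∃ u₁ y₁ u₂ y₂, S.IsFundamental u₁ y₁ u₂ y₂ := by
  have hp0 := p_ne (S := S) zero_mem
  have hp1 := p_ne (S := S) one_mem
  obtain ⟨s, ys, hs, s0, ys0⟩ := exists_solves_zero (S := S) 1 0
  obtain ⟨c, yc, hc, c0, yc0⟩ := exists_solves_zero (S := S) 0 1
  have hW := hs.wronskian_eq hc one_mem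
  rw [s0, ys0, c0, yc0] at hW
  obtain ⟨u₁, y₁, h₁, hu₁, hy₁⟩ := exists_solves_zero (S := S) S.b₂ (-S.b₁ * S.p 0)
  -- The coefficients prescribe u₂(1) = a₂ and y₂(1) = -a₁ p(1), by Cramer's rule for the basis s, c
  -- of Wronskian 1.
  have h₂ := (hs.const_mul (S.a₂ * yc 1 + S.a₁ * S.p 1 * c 1)).add
    (hc.const_mul (-(S.a₂ * ys 1) - S.a₁ * S.p 1 * s 1))
  simp only [mul_zero, add_zero] at h₂
  obtain ⟨u₂, hu₂⟩ : ∃ u₂, u₂ = fun z => (S.a₂ * yc 1 + S.a₁ * S.p 1 * c 1) * s z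
    + (-(S.a₂ * ys 1) - S.a₁ * S.p 1 * s 1) * c z := ⟨_, rfl⟩
  obtain ⟨y₂, hy₂⟩ : ∃ y₂, y₂ = fun z => (S.a₂ * yc 1 + S.a₁ * S.p 1 * c 1) * ys z
    + (-(S.a₂ * ys 1) - S.a₁ * S.p 1 * s 1) * yc z := ⟨_, rfl⟩
  rw [← hu₂, ← hy₂] at h₂
  have e1 : u₂ 1 = S.a₂ := by
    rw [hu₂]
    linear_combination S.a₂ * hW
  have e2 : y₂ 1 = -S.a₁ * S.p 1 := by
    rw [hy₂]
    linear_combination -S.a₁ * S.p 1 * hW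
  have bc₂ : S.a₁ * u₂ 1 + S.a₂ * (y₂ 1 / S.p 1) = 0 := by
    rw [e1, e2]
    field_simp
    ring
  have bc₁ : S.b₁ * u₁ 0 + S.b₂ * (y₁ 0 / S.p 0) = 0 := by
    rw [hu₁, hy₁]
    field_simp
    ring
  have ne : S.b₁ * u₂ 0 + S.b₂ * (y₂ 0 / S.p 0) ≠ 0 := by
    intro h
    have hz := Solves.eq_zero_of_not_isEigenvalue (l := 0) (u := u₂) (y := y₂) h0
      (by simpa using h₂) ⟨h, bc₂⟩
    have ha2 : S.a₂ = 0 := by rw [← e1]; exact hz one_mem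
    have ha1 : -S.a₁ * S.p 1 = 0 := by rw [← e2]; exact h₂.flux_eq_zero hz one_mem
    have ha1 : S.a₁ = 0 := by simpa [hp1] using ha1
    have := S.a_ne
    simp [ha1, ha2] at this
  obtain ⟨W, hWdef⟩ : ∃ W, W = u₁ 0 * y₂ 0 - u₂ 0 * y₁ 0 := ⟨_, rfl⟩
  -- W is p(0) times the boundary expression in `ne`. Dividing u₂ by W normalizes the Wronskian.
  have hWne : W ≠ 0 := by
    rw [hWdef, hu₁, hy₁]
    intro h
    apply ne
    field_simp
    linear_combination h
  have h₂' := h₂.const_mul W⁻¹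
  simp only [mul_zero] at h₂'
  refine ⟨u₁, y₁, _, _, h₁, h₂', bc₁, ?_, ?_, fun z hz => ?_⟩
  · linear_combination W⁻¹ * bc₂
  · intro h
    refine mul_ne_zero (inv_ne_zero hWne) ne ?_
    linear_combination h
  · have := h₁.wronskian_eq h₂ hz
    rw [← hWdef] at this
    field_simp
    linear_combination this

end SturmLiouville

/-! ### The weighted `L²` space and the Green operator. -/

namespace SturmLiouville

open MeasureTheory

variable {S : SturmLiouville} {u y g v w k : ℝ → ℝ}

/-- The measure `r dz` on `[0,1]`. -/
noncomputable def weight (S : SturmLiouville) : Measure (Icc (0 : ℝ) 1) :=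
  volume.withDensity fun z => ENNReal.ofReal (restr S.r S.r_continuousOn z)

instance : IsFiniteMeasure S.weight := by
  refine isFiniteMeasure_withDensity_ofReal ?_
  exact ((restr S.r S.r_continuousOn).continuous.integrable_of_hasCompactSupport
    (HasCompactSupport.of_compactSpace _)).2

/-- Continuous functions as elements of the weighted space `L²([0,1], r dz)`. -/
noncomputable def toL2 (S : SturmLiouville) : CI →L[ℝ] Lp ℝ 2 S.weight :=
  ContinuousMap.toLp 2 S.weight ℝ

theorem integral_weight (f : CI) :
    ∫ z, f z ∂S.weight = ∫ z in (0 : ℝ)..1, S.r z * ext f z := by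
  have hm : Measurable fun z => ENNReal.ofReal (restr S.r S.r_continuousOn z) :=
    (restr S.r S.r_continuousOn).continuous.measurable.ennreal_ofReal
  rw [weight, integral_withDensity_eq_integral_toReal_smul hm (by simp),
    intervalIntegral.integral_of_le zero_le_one, ← integral_Icc_eq_integral_Ioc,
    ← integral_subtype measurableSet_Icc]
  refine integral_congr_ae (Filter.Eventually.of_forall fun z => ?_)
  have hr : 0 ≤ restr S.r S.r_continuousOn z := (S.r_pos z z.2).le
  simp only [ext_coe, smul_eq_mul, ENNReal.toReal_ofReal hr]
  rfl

theorem inner_toL2 (f g : CI) :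
    inner ℝ (S.toL2 f) (S.toL2 g) = ∫ z in (0 : ℝ)..1, S.r z * (ext f z * ext g z) := by
  have h := ContinuousMap.inner_toLp (𝕜 := ℝ) S.weight f g
  rw [toL2, h]
  have := integral_weight (S := S) (f * g)
  refine Eq.trans ?_ (this.trans ?_)
  · exact integral_congr_ae (Filter.Eventually.of_forall fun z => by simp [mul_comm])
  · rfl

/-- As r > 0, a vanishing norm forces f = 0 almost everywhere, hence everywhere by continuity. -/
theorem toL2_injective : Function.Injective S.toL2 := by
  refine (injective_iff_map_eq_zero S.toL2).2 fun f hf => ?_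
  have h0 : ∫ z in (0 : ℝ)..1, S.r z * (ext f z * ext f z) = 0 := by
    rw [← inner_toL2, hf, inner_zero_left]
  have hc : ContinuousOn (fun z => S.r z * (ext f z * ext f z)) (Icc 0 1) :=
    S.r_continuousOn.mul ((continuous_ext f).mul (continuous_ext f)).continuousOn
  rw [intervalIntegral.integral_eq_zero_iff_of_le_of_nonneg_ae zero_le_one] at h0
  · rw [← Measure.restrict_congr_set Ioc_ae_eq_Icc.symm] at h0
    have h1 := Measure.eqOn_Icc_of_ae_eq volume zero_ne_one h0 hc continuousOn_const
    ext z
    have h2 : S.r z * (ext f z * ext f z) = 0 := h1 z.2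
    simpa [ext_coe, (S.r_pos z z.2).ne'] using h2
  · refine (ae_restrict_iff' measurableSet_Ioc).2 (Filter.Eventually.of_forall fun z hz => ?_)
    exact mul_nonneg (S.r_pos z (Ioc_subset_Icc_self hz)).le (mul_self_nonneg _)
  · exact ContinuousOn.intervalIntegrable (by rwa [uIcc_of_le zero_le_one])

/-- The operator `f ↦ (z ↦ ∫ s in 0..z, m s * f s)`. -/
noncomputable def volterra (m : CI) : CI →L[ℝ] CI :=
  LinearMap.mkContinuous
    { toFun := fun f => restr (fun z => ∫ s in (0 : ℝ)..z, ext m s * ext f s)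
        (intervalIntegral.continuous_primitive (fun _ _ =>
          ((continuous_ext m).mul (continuous_ext f)).intervalIntegrable _ _) 0).continuousOn
      map_add' := fun f g => by
        ext z
        have h : ∀ f, IntervalIntegrable (fun s => ext m s * ext f s) volume 0 z := fun f =>
          ((continuous_ext m).mul (continuous_ext f)).intervalIntegrable _ _
        change ∫ s in (0 : ℝ)..z, ext m s * (ext f s + ext g s) = _
        simp only [mul_add]
        exact intervalIntegral.integral_add (h f) (h g)
      map_smul' := fun c f => by
        ext z
        change ∫ s in (0 : ℝ)..z, ext m s * (c * ext f s) = _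
        simp only [mul_left_comm _ c]
        exact intervalIntegral.integral_const_mul _ _ }
    ‖m‖ fun f => by
      refine (ContinuousMap.norm_le _ (by positivity)).2 fun z => ?_
      refine (intervalIntegral.norm_integral_le_of_norm_le_const (C := ‖m‖ * ‖f‖)
        fun s _ => ?_).trans ?_
      · rw [norm_mul]
        exact mul_le_mul (abs_ext_le m s) (abs_ext_le f s) (norm_nonneg _) (norm_nonneg _)
      · rw [sub_zero, abs_of_nonneg z.2.1]
        exact mul_le_of_le_one_right (by positivity) z.2.2

theorem volterra_apply (m f : CI) (z : Icc (0 : ℝ) 1) :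
    volterra m f z = ∫ s in (0 : ℝ)..z, ext m s * ext f s := rfl

/-- The operator `f ↦ (z ↦ ∫ s in z..1, m s * f s)`. -/
noncomputable def covolterra (m : CI) : CI →L[ℝ] CI :=
  ((ContinuousMap.evalCLM ℝ (1 : Icc (0 : ℝ) 1)).comp (volterra m)).smulRight (1 : CI) - volterra m

theorem covolterra_apply (m f : CI) (z : Icc (0 : ℝ) 1) :
    covolterra m f z = ∫ s in (z : ℝ)..1, ext m s * ext f s := by
  have h : ∀ a b, IntervalIntegrable (fun s => ext m s * ext f s) volume a b :=
    ((continuous_ext m).mul (continuous_ext f)).intervalIntegrable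
  rw [← intervalIntegral.integral_interval_sub_left (h 0 1) (h 0 z)]
  simp [covolterra, volterra_apply]

/-- The operator from which the Green operator and its flux are obtained. -/
noncomputable def greenForm (a m b n : CI) : CI →L[ℝ] CI :=
  -((ContinuousLinearMap.mul ℝ CI a).comp (volterra m)
    + (ContinuousLinearMap.mul ℝ CI b).comp (covolterra n))

theorem greenForm_apply (a m b n f : CI) (z : Icc (0 : ℝ) 1) :
    greenForm a m b n f z = -(a z * (∫ s in (0 : ℝ)..z, ext m s * ext f s)
      + b z * ∫ s in (z : ℝ)..1, ext n s * ext f s) := by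
  rw [← volterra_apply, ← covolterra_apply]
  rfl

namespace IsFundamental

variable {u₁ y₁ u₂ y₂ : ℝ → ℝ}

/-- The Green operator, the inverse of the Sturm-Liouville operator. -/
noncomputable def green (hF : S.IsFundamental u₁ y₁ u₂ y₂) : CI →L[ℝ] CI :=
  greenForm (restr u₂ hF.solves₂.continuousOn)
    (restr _ (S.r_continuousOn.mul hF.solves₁.continuousOn))
    (restr u₁ hF.solves₁.continuousOn) (restr _ (S.r_continuousOn.mul hF.solves₂.continuousOn))

/-- The flux of the Green operator. -/
noncomputable def greenFlux (hF : S.IsFundamental u₁ y₁ u₂ y₂) : CI →L[ℝ] CI :=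
  greenForm (restr y₂ hF.solves₂.continuousOn_flux)
    (restr _ (S.r_continuousOn.mul hF.solves₁.continuousOn))
    (restr y₁ hF.solves₁.continuousOn_flux)
    (restr _ (S.r_continuousOn.mul hF.solves₂.continuousOn))

/-- Variation of constants: the derivatives of the two integrals cancel in u', and in y' they
combine to the Wronskian, which is 1. -/
theorem solves_green (hF : S.IsFundamental u₁ y₁ u₂ y₂) (f : CI) :
    S.Solves (ext (hF.green f)) (ext (hF.greenFlux f)) (ext f) := by
  set M₁ := restr _ (S.r_continuousOn.mul hF.solves₁.continuousOn) with hM₁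
  set M₂ := restr _ (S.r_continuousOn.mul hF.solves₂.continuousOn) with hM₂
  have hc₁ := (continuous_ext M₁).mul (continuous_ext f)
  have hc₂ := (continuous_ext M₂).mul (continuous_ext f)
  have hu : EqOn (ext (hF.green f)) (fun z => -(u₂ z * (∫ s in (0 : ℝ)..z, ext M₁ s * ext f s)
      + u₁ z * ∫ s in z..1, ext M₂ s * ext f s)) (Icc 0 1) := fun z hz => by
    rw [ext_apply _ hz, green, greenForm_apply]
    rfl
  have hy : EqOn (ext (hF.greenFlux f)) (fun z => -(y₂ z * (∫ s in (0 : ℝ)..z, ext M₁ s * ext f s)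
      + y₁ z * ∫ s in z..1, ext M₂ s * ext f s)) (Icc 0 1) := fun z hz => by
    rw [ext_apply _ hz, greenFlux, greenForm_apply]
    rfl
  intro z hz
  have hp := p_ne (S := S) hz
  have d₁ : HasDerivWithinAt (fun z => ∫ s in (0 : ℝ)..z, ext M₁ s * ext f s)
      (S.r z * u₁ z * ext f z) (Icc 0 1) z := by
    have := (hc₁.integral_hasStrictDerivAt 0 z).hasDerivAt.hasDerivWithinAt (s := Icc 0 1)
    rwa [Pi.mul_apply, hM₁, ext_restr _ hz] at this
  have d₂ : HasDerivWithinAt (fun z => ∫ s in z..1, ext M₂ s * ext f s)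
      (-(S.r z * u₂ z * ext f z)) (Icc 0 1) z := by
    have := (hc₂.integral_hasStrictDerivAt 1 z).hasDerivAt.neg.hasDerivWithinAt (s := Icc 0 1)
    rw [Pi.mul_apply, hM₂, ext_restr _ hz] at this
    refine this.congr_of_eventuallyEq (Filter.Eventually.of_forall fun x => ?_) ?_
    · exact intervalIntegral.integral_symm _ _
    · exact intervalIntegral.integral_symm _ _
  constructor
  · refine (((((hF.solves₂ z hz).1.mul d₁).add ((hF.solves₁ z hz).1.mul d₂)).neg).congr_deriv
      ?_).congr hu (hu hz)
    rw [hy hz]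
    field_simp
    ring
  · refine (((((hF.solves₂ z hz).2.mul d₁).add ((hF.solves₁ z hz).2.mul d₂)).neg).congr_deriv
      ?_).congr hy (hy hz)
    rw [hu hz]
    linear_combination -(S.r z * ext f z) * hF.wronskian z hz

/-- At each end point one integral is over a trivial interval, leaving a multiple of the fundamental
solution that satisfies the condition there. -/
theorem BC_green (hF : S.IsFundamental u₁ y₁ u₂ y₂) (f : CI) :
    S.BC (ext (hF.green f)) (ext (hF.greenFlux f)) := by
  constructor
  · rw [ext_apply _ zero_mem, ext_apply _ zero_mem, green, greenFlux, greenForm_apply,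
      greenForm_apply]
    simp only [intervalIntegral.integral_same, restr_apply]
    linear_combination (-∫ s in (0 : ℝ)..1,
      ext (restr _ (S.r_continuousOn.mul hF.solves₂.continuousOn)) s * ext f s) * hF.bc₁
  · rw [ext_apply _ one_mem, ext_apply _ one_mem, green, greenFlux, greenForm_apply,
      greenForm_apply]
    simp only [intervalIntegral.integral_same, restr_apply]
    linear_combination (-∫ s in (0 : ℝ)..1,
      ext (restr _ (S.r_continuousOn.mul hF.solves₁.continuousOn)) s * ext f s) * hF.bc₂

/-- The Green function, as a continuous curve of continuous functions. -/
noncomputable def kernel (hF : S.IsFundamental u₁ y₁ u₂ y₂) : C(Icc (0 : ℝ) 1, CI) :=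
  ContinuousMap.curry ⟨fun a => -(restr u₁ hF.solves₁.continuousOn (min a.1 a.2)
    * restr u₂ hF.solves₂.continuousOn (max a.1 a.2)), by fun_prop⟩

theorem ext_kernel_of_le (hF : S.IsFundamental u₁ y₁ u₂ y₂) (z : Icc (0 : ℝ) 1) {s : ℝ}
    (hs : s ∈ Icc (0 : ℝ) 1) (h : s ≤ z) : ext (hF.kernel z) s = -(u₁ s * u₂ z) := by
  rw [ext_apply _ hs]
  have h' : (⟨s, hs⟩ : Icc (0 : ℝ) 1) ≤ z := h
  change -(_ * _) = _
  simp only [min_eq_right h', max_eq_left h']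
  rfl

theorem ext_kernel_of_ge (hF : S.IsFundamental u₁ y₁ u₂ y₂) (z : Icc (0 : ℝ) 1) {s : ℝ}
    (hs : s ∈ Icc (0 : ℝ) 1) (h : z ≤ s) : ext (hF.kernel z) s = -(u₁ z * u₂ s) := by
  rw [ext_apply _ hs]
  have h' : z ≤ (⟨s, hs⟩ : Icc (0 : ℝ) 1) := h
  change -(_ * _) = _
  simp only [min_eq_left h', max_eq_right h']
  rfl

/-- The Green operator on the weighted space `L²`. -/
noncomputable def greenL2 (hF : S.IsFundamental u₁ y₁ u₂ y₂) : Lp ℝ 2 S.weight →L[ℝ] CI :=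
  innerOperator ((⟨S.toL2, S.toL2.continuous⟩ : C(CI, Lp ℝ 2 S.weight)).comp hF.kernel)

theorem greenL2_toL2 (hF : S.IsFundamental u₁ y₁ u₂ y₂) (f : CI) :
    hF.greenL2 (S.toL2 f) = hF.green f := by
  ext z
  rw [greenL2, innerOperator_apply]
  change inner ℝ (S.toL2 (hF.kernel z)) (S.toL2 f) = _
  rw [inner_toL2, green, greenForm_apply]
  have hc : ContinuousOn (fun s => S.r s * (ext (hF.kernel z) s * ext f s)) (Icc 0 1) :=
    S.r_continuousOn.mul ((continuous_ext _).mul (continuous_ext f)).continuousOn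
  have hz0 := z.2.1
  have hz1 := z.2.2
  rw [← intervalIntegral.integral_add_adjacent_intervals (b := z)
    (ContinuousOn.intervalIntegrable (hc.mono (by
      rw [uIcc_of_le hz0]; exact Icc_subset_Icc_right hz1)))
    (ContinuousOn.intervalIntegrable (hc.mono (by
      rw [uIcc_of_le hz1]; exact Icc_subset_Icc_left hz0))), neg_add,
    ← neg_mul, ← neg_mul, ← intervalIntegral.integral_const_mul,
    ← intervalIntegral.integral_const_mul]
  congr 1
  · refine intervalIntegral.integral_congr fun s hs => ?_
    rw [uIcc_of_le hz0] at hs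
    have hs' : s ∈ Icc (0 : ℝ) 1 := ⟨hs.1, hs.2.trans hz1⟩
    simp only [hF.ext_kernel_of_le z hs' hs.2, ext_restr _ hs']
    simp only [restr_apply, Pi.mul_apply]
    ring
  · refine intervalIntegral.integral_congr fun s hs => ?_
    rw [uIcc_of_le hz1] at hs
    have hs' : s ∈ Icc (0 : ℝ) 1 := ⟨hz0.trans hs.1, hs.2⟩
    simp only [hF.ext_kernel_of_ge z hs' hs.1, ext_restr _ hs']
    simp only [restr_apply, Pi.mul_apply]
    ring

theorem inner_green (hF : S.IsFundamental u₁ y₁ u₂ y₂) (f g : CI) :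
    inner ℝ (S.toL2 (hF.green f)) (S.toL2 g) = inner ℝ (S.toL2 f) (S.toL2 (hF.green g)) := by
  have h := (hF.solves_green g).integral_eq_zero (hF.solves_green f)
    (continuous_ext g).continuousOn (continuous_ext f).continuousOn (hF.BC_green g) (hF.BC_green f)
  rw [inner_toL2, inner_toL2, ← sub_eq_zero, ← intervalIntegral.integral_sub]
  · refine Eq.trans ?_ h
    exact intervalIntegral.integral_congr fun z _ => by ring
  all_goals
    refine ContinuousOn.intervalIntegrable ?_
    rw [uIcc_of_le zero_le_one]
    exact S.r_continuousOn.mul ((continuous_ext _).mul (continuous_ext _)).continuousOn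

/-- The Green operator as a compact symmetric operator. -/
noncomputable def resolvent (hF : S.IsFundamental u₁ y₁ u₂ y₂) :
    Lp ℝ 2 S.weight →L[ℝ] Lp ℝ 2 S.weight := S.toL2.comp hF.greenL2

theorem isCompactOperator_resolvent (hF : S.IsFundamental u₁ y₁ u₂ y₂) :
    IsCompactOperator hF.resolvent :=
  (isCompactOperator_innerOperator _).clm_comp S.toL2

theorem resolvent_toL2 (hF : S.IsFundamental u₁ y₁ u₂ y₂) (f : CI) :
    hF.resolvent (S.toL2 f) = S.toL2 (hF.green f) :=
  congrArg S.toL2 (hF.greenL2_toL2 f)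

/-- Green's identity gives symmetry on continuous functions, which are dense in `L²`. -/
theorem isSymmetric_resolvent (hF : S.IsFundamental u₁ y₁ u₂ y₂) :
    (hF.resolvent : Lp ℝ 2 S.weight →ₗ[ℝ] Lp ℝ 2 S.weight).IsSymmetric := by
  have hd : DenseRange S.toL2 := ContinuousMap.toLp_denseRange ℝ S.weight ℝ (by norm_num)
  intro F G
  refine hd.induction_on₂ (p := fun F G => inner ℝ (hF.resolvent F) G
    = inner ℝ F (hF.resolvent G)) (isClosed_eq (by fun_prop) (by fun_prop)) (fun f g => ?_) F G
  simp only [resolvent_toL2]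
  exact hF.inner_green f g

theorem green_injective (hF : S.IsFundamental u₁ y₁ u₂ y₂) : Function.Injective hF.green := by
  refine (injective_iff_map_eq_zero hF.green).2 fun f hf => ?_
  ext z
  have h := (hF.solves_green f).op_eq z.2
  have h0 : S.Solves (fun _ => 0) (fun _ => 0) (fun _ => 0) := fun z _ =>
    ⟨by simpa using hasDerivWithinAt_const z (Icc (0 : ℝ) 1) (0 : ℝ),
      by simpa using hasDerivWithinAt_const z (Icc (0 : ℝ) 1) (0 : ℝ)⟩
  rw [op_congr (f := fun _ => 0) (fun z hz => by rw [hf, ext_apply _ hz]; rfl) z.2,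
    h0.op_eq z.2, ext_coe] at h
  exact h.symm

end IsFundamental
end SturmLiouville

/-! ### Completeness and uniformly convergent eigenfunction expansions. -/

namespace SturmLiouville

open MeasureTheory

variable {S : SturmLiouville} {u y g v w k : ℝ → ℝ}

theorem BC.add (h : S.BC u y) (h' : S.BC v w) :
    S.BC (fun z => u z + v z) (fun z => y z + w z) :=
  ⟨by linear_combination h.1 + h'.1, by linear_combination h.2 + h'.2⟩

theorem BC.const_mul (c : ℝ) (h : S.BC u y) : S.BC (fun z => c * u z) (fun z => c * y z) :=
  ⟨by linear_combination c * h.1, by linear_combination c * h.2⟩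

/-- The difference of the two sides would be an eigenfunction for `0` if it were not zero. -/
theorem IsFundamental.green_eq {u₁ y₁ u₂ y₂ : ℝ → ℝ} (hF : S.IsFundamental u₁ y₁ u₂ y₂)
    (h0 : ¬ S.IsEigenvalue 0) (h : S.Solves u y g) (hg : ContinuousOn g (Icc 0 1))
    (hb : S.BC u y) : hF.green (restr g hg) = restr u h.continuousOn := by
  have h1 := h.add ((hF.solves_green (restr g hg)).const_mul (-1))
  have h2 := (h1.congr (k := fun z => 0 * (u z + -1 * ext (hF.green (restr g hg)) z))
    (fun _ _ => rfl) fun z hz => by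
      simp only [ext_restr hg hz]; ring).eq_zero_of_not_isEigenvalue h0
    (hb.add ((hF.BC_green _).const_mul (-1)))
  ext z
  have h3 : u z + -1 * ext (hF.green (restr g hg)) z = 0 := h2 z.2
  rw [ext_coe] at h3
  rw [restr_apply]
  linarith

/-- Solutions with the same boundary condition at `0` are proportional. -/
theorem Solves.exists_eqOn_const_mul {l : ℝ} (h : S.Solves u y (fun z => l * u z))
    (h' : S.Solves v w (fun z => l * v z)) (hb : S.BC u y) (hb' : S.BC v w)
    (hv : ∃ z ∈ Icc (0 : ℝ) 1, v z ≠ 0) : ∃ a : ℝ, EqOn u (fun z => a * v z) (Icc 0 1) := by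
  have hW := hb.wronskian_zero hb'
  obtain ⟨a, ha, ha'⟩ : ∃ a, u 0 = a * v 0 ∧ y 0 = a * w 0 := by
    by_cases hv0 : v 0 = 0
    · have hw0 : w 0 ≠ 0 := by
        intro hw0
        obtain ⟨z, hz, hne⟩ := hv
        exact hne (h'.eq_zero hv0 hw0 hz)
      refine ⟨y 0 / w 0, ?_, by field_simp⟩
      have : u 0 * w 0 = 0 := by simpa [hv0] using hW
      simp [(mul_eq_zero.1 this).resolve_right hw0, hv0]
    · refine ⟨u 0 / v 0, by field_simp, ?_⟩
      field_simp
      linear_combination -hW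
  refine ⟨a, fun z hz => ?_⟩
  have hd := (h.add (h'.const_mul (-a))).congr (k := fun z => l * (u z + -a * v z))
    (fun _ _ => rfl) fun z hz => by ring
  have : u z + -a * v z = 0 := hd.eq_zero (by rw [ha]; ring) (by rw [ha']; ring) hz
  simp only
  linarith

namespace IsEigenSequence

variable {lam : ℕ → ℝ} {phi : ℕ → ℝ → ℝ} {u₁ y₁ u₂ y₂ : ℝ → ℝ}

theorem pos (hE : S.IsEigenSequence lam phi) (h0 : 0 < lam 0) (n : ℕ) : 0 < lam n :=
  h0.trans_le (hE.strictMono.monotone n.zero_le)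

theorem not_isEigenvalue_zero (hE : S.IsEigenSequence lam phi) (h0 : 0 < lam 0) :
    ¬ S.IsEigenvalue 0 := by
  rw [← hE.mem_range_iff]
  rintro ⟨n, hn⟩
  exact (hE.pos h0 n).ne' hn

/-- The eigenfunctions as elements of `C([0,1])`. -/
noncomputable def eigenfunction (hE : S.IsEigenSequence lam phi) (n : ℕ) : CI :=
  restr (phi n) (hE.solves n).1.1.continuousOn

theorem ext_eigenfunction (hE : S.IsEigenSequence lam phi) (n : ℕ) {z : ℝ}
    (hz : z ∈ Icc (0 : ℝ) 1) : ext (hE.eigenfunction n) z = phi n z := ext_restr _ hz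

theorem green_eigenfunction (hE : S.IsEigenSequence lam phi) (h0 : 0 < lam 0)
    (hF : S.IsFundamental u₁ y₁ u₂ y₂) (n : ℕ) :
    hF.green (hE.eigenfunction n) = (lam n)⁻¹ • hE.eigenfunction n := by
  have hs := (hE.solves n).solves
  have h := hF.green_eq (hE.not_isEigenvalue_zero h0) hs
    (continuousOn_const.mul hs.continuousOn) (BC_flux (hE.solves n).1)
  have h' : hF.green (lam n • hE.eigenfunction n) = hE.eigenfunction n := h
  rwa [eq_inv_smul_iff₀ (hE.pos h0 n).ne', ← map_smul]

theorem inner_eigenfunction_self (hE : S.IsEigenSequence lam phi) (n : ℕ) :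
    inner ℝ (S.toL2 (hE.eigenfunction n)) (S.toL2 (hE.eigenfunction n)) = 1 := by
  refine (inner_toL2 _ _).trans (Eq.trans ?_ (hE.normalized n))
  refine intervalIntegral.integral_congr fun z hz => ?_
  rw [uIcc_of_le zero_le_one] at hz
  simp only [hE.ext_eigenfunction n hz]
  ring

theorem norm_toL2_eigenfunction (hE : S.IsEigenSequence lam phi) (n : ℕ) :
    ‖S.toL2 (hE.eigenfunction n)‖ = 1 := by
  have h := hE.inner_eigenfunction_self n
  rw [real_inner_self_eq_norm_sq] at h
  exact (pow_eq_one_iff_of_nonneg (norm_nonneg _) two_ne_zero).1 h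

theorem inner_eigenfunction_of_ne (hE : S.IsEigenSequence lam phi) (h0 : 0 < lam 0)
    (hF : S.IsFundamental u₁ y₁ u₂ y₂) {n m : ℕ} (hnm : n ≠ m) :
    inner ℝ (S.toL2 (hE.eigenfunction n)) (S.toL2 (hE.eigenfunction m)) = 0 := by
  have h := hF.inner_green (hE.eigenfunction n) (hE.eigenfunction m)
  rw [hE.green_eigenfunction h0 hF, hE.green_eigenfunction h0 hF, map_smul, map_smul,
    real_inner_smul_left, real_inner_smul_right, ← sub_eq_zero, ← sub_mul] at h
  refine (mul_eq_zero.1 h).resolve_left (sub_ne_zero.2 fun h => hnm ?_)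
  exact hE.strictMono.injective (inv_injective h)

theorem exists_ne_zero (hE : S.IsEigenSequence lam phi) (n : ℕ) :
    ∃ z ∈ Icc (0 : ℝ) 1, phi n z ≠ 0 := by
  by_contra! h
  have h1 : hE.eigenfunction n = 0 := by
    ext z
    exact h z z.2
  have := hE.inner_eigenfunction_self n
  simp [h1] at this

/-- The Fourier coefficients with respect to the eigenfunctions. -/
noncomputable def coeff (hE : S.IsEigenSequence lam phi) (f : CI) (n : ℕ) : ℝ :=
  inner ℝ (S.toL2 (hE.eigenfunction n)) (S.toL2 f)

theorem coeff_green (hE : S.IsEigenSequence lam phi) (h0 : 0 < lam 0)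
    (hF : S.IsFundamental u₁ y₁ u₂ y₂) (f : CI) (n : ℕ) :
    hE.coeff (hF.green f) n = (lam n)⁻¹ * hE.coeff f n := by
  rw [coeff, ← hF.inner_green, hE.green_eigenfunction h0, map_smul, real_inner_smul_left, coeff]

/-- Every eigenfunction of the Green operator is a multiple of a member of the sequence. -/
theorem exists_eq_smul (hE : S.IsEigenSequence lam phi)
    (hF : S.IsFundamental u₁ y₁ u₂ y₂) {f : CI} {μ : ℝ} (hμ : μ ≠ 0) (hf : hF.green f = μ • f) :
    ∃ (n : ℕ) (a : ℝ), f = a • hE.eigenfunction n := by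
  by_cases hf0 : f = 0
  · exact ⟨0, 0, by simp [hf0]⟩
  have hs : S.Solves (ext f) (fun z => μ⁻¹ * ext (hF.greenFlux f) z) (fun z => μ⁻¹ * ext f z) := by
    refine ((hF.solves_green f).const_mul μ⁻¹).congr (fun z hz => ?_) fun _ _ => rfl
    rw [hf]
    simp [ext_apply _ hz, hμ]
  have hb : S.BC (ext f) (fun z => μ⁻¹ * ext (hF.greenFlux f) z) := by
    have := (hF.BC_green f).const_mul μ⁻¹
    rw [hf] at this
    simpa [BC, ext_apply _ zero_mem, ext_apply _ one_mem, hμ] using this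
  obtain ⟨z, hz⟩ : ∃ z, f z ≠ 0 := by
    by_contra! h
    exact hf0 (ContinuousMap.ext h)
  have hev : S.IsEigenvalue μ⁻¹ :=
    ⟨_, hs.solvesEigenEquation hb, z, z.2, by rwa [ext_coe]⟩
  obtain ⟨n, hn⟩ := (hE.mem_range_iff _).2 hev
  have hs' := (hE.solves n).solves
  rw [hn] at hs'
  obtain ⟨a, ha⟩ := hs.exists_eqOn_const_mul hs' hb (BC_flux (hE.solves n).1) (hE.exists_ne_zero n)
  refine ⟨n, a, ContinuousMap.ext fun z => ?_⟩
  rw [← ext_coe, ha z.2]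
  rfl

/-- Completeness of the eigenfunctions. -/
theorem eq_zero_of_coeff_eq_zero (hE : S.IsEigenSequence lam phi)
    (hF : S.IsFundamental u₁ y₁ u₂ y₂) {f : CI} (hf : ∀ n, hE.coeff f n = 0) : f = 0 := by
  -- It is G f, not f, that is shown orthogonal to every eigenspace: ⟨G f, F⟩ = μ ⟨f, F⟩ disposes of
  -- μ = 0 without describing the kernel of G on `L²`. For μ ≠ 0 the vector μ F is a continuous
  -- eigenfunction, hence a multiple of some φ_n.
  refine hF.green_injective ?_
  rw [map_zero]
  refine S.toL2_injective ?_
  rw [map_zero]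
  have hT := hF.isSymmetric_resolvent
  have hbot := ContinuousLinearMap.orthogonalComplement_iSup_eigenspaces_eq_bot
    hF.isCompactOperator_resolvent hT
  rw [← Submodule.mem_bot ℝ, ← hbot, Submodule.mem_orthogonal]
  intro F hF'
  rw [← hF.resolvent_toL2]
  suffices hle : (⨆ μ, Module.End.eigenspace
      (hF.resolvent : Lp ℝ 2 S.weight →ₗ[ℝ] Lp ℝ 2 S.weight) μ)
      ≤ LinearMap.ker (innerSL ℝ (hF.resolvent (S.toL2 f))).toLinearMap by
    rw [real_inner_comm]
    exact hle hF'
  refine iSup_le fun μ F hFμ => ?_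
  have hFμ : hF.resolvent F = μ • F := Module.End.mem_eigenspace_iff.1 hFμ
  have hsymm : inner ℝ (hF.resolvent (S.toL2 f)) F = inner ℝ (S.toL2 f) (μ • F) := by
    rw [← hFμ]
    exact hT _ _
  change inner ℝ (hF.resolvent (S.toL2 f)) F = 0
  rw [hsymm]
  by_cases hμ : μ = 0
  · simp [hμ]
  have hFc : μ • F = S.toL2 (hF.greenL2 F) := hFμ.symm
  have hc : hF.green (hF.greenL2 F) = μ • hF.greenL2 F := by
    rw [← hF.greenL2_toL2, ← hFc, map_smul]
  obtain ⟨n, a, ha⟩ := hE.exists_eq_smul hF hμ hc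
  rw [hFc, ha, map_smul, real_inner_smul_right, real_inner_comm]
  exact mul_eq_zero_of_right _ (hf n)

theorem abs_coeff_le (hE : S.IsEigenSequence lam phi) (f : CI) (n : ℕ) :
    |hE.coeff f n| ≤ ‖S.toL2 f‖ := by
  have := norm_inner_le_norm (𝕜 := ℝ) (S.toL2 (hE.eigenfunction n)) (S.toL2 f)
  rwa [hE.norm_toL2_eigenfunction, one_mul] at this

/-- (H) restated with the norm of C([0,1]). -/
theorem summable_norm (hE : S.IsEigenSequence lam phi) (h0 : 0 < lam 0)
    (hs : Summable fun n => (lam n)⁻¹ * sSup ((fun z => |phi n z|) '' Icc 0 1)) :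
    Summable fun n => (lam n)⁻¹ * ‖hE.eigenfunction n‖ := by
  refine hs.of_nonneg_of_le (fun n => ?_) fun n => ?_
  · have := hE.pos h0 n
    positivity
  · have := hE.pos h0 n
    have hb : BddAbove ((fun z => |phi n z|) '' Icc 0 1) :=
      (isCompact_Icc.image_of_continuousOn (hE.solves n).1.1.continuousOn.abs).bddAbove
    gcongr
    rw [ContinuousMap.norm_le_of_nonempty]
    exact fun z => le_csSup hb ⟨z, z.2, rfl⟩

/-- A function whose coefficients decay suitably is the sum of its expansion. -/
theorem hasSum_coeff (hE : S.IsEigenSequence lam phi) (h0 : 0 < lam 0)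
    (hF : S.IsFundamental u₁ y₁ u₂ y₂)
    (hs : Summable fun n => (lam n)⁻¹ * ‖hE.eigenfunction n‖) (f : CI) :
    HasSum (fun n => hE.coeff (hF.green f) n • hE.eigenfunction n) (hF.green f) := by
  have hsum : Summable fun n => hE.coeff (hF.green f) n • hE.eigenfunction n := by
    refine Summable.of_norm_bounded (hs.mul_left ‖S.toL2 f‖) fun n => ?_
    have := hE.pos h0 n
    rw [norm_smul, hE.coeff_green h0, norm_mul, norm_inv, Real.norm_of_nonneg this.le, mul_assoc,
      mul_left_comm, Real.norm_eq_abs]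
    gcongr
    exact hE.abs_coeff_le f n
  have h := hsum.hasSum
  set s := ∑' n, hE.coeff (hF.green f) n • hE.eigenfunction n
  -- The uniform limit s has the same coefficients as G f, by orthonormality; completeness
  -- identifies the two.
  suffices hz : ∀ n, hE.coeff (s - hF.green f) n = 0 by
    have h' : s = hF.green f := sub_eq_zero.1 (hE.eq_zero_of_coeff_eq_zero hF hz)
    exact h' ▸ h
  intro n
  have h1 := h.mapL ((innerSL ℝ (S.toL2 (hE.eigenfunction n))).comp S.toL2)
  have h2 : HasSum (fun m => ((innerSL ℝ (S.toL2 (hE.eigenfunction n))).comp S.toL2)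
      (hE.coeff (hF.green f) m • hE.eigenfunction m)) (hE.coeff (hF.green f) n) := by
    have : hE.coeff (hF.green f) n = ((innerSL ℝ (S.toL2 (hE.eigenfunction n))).comp S.toL2)
        (hE.coeff (hF.green f) n • hE.eigenfunction n) := by
      simp [hE.norm_toL2_eigenfunction]
    rw [this]
    refine hasSum_single n fun m hm => ?_
    simp [hE.inner_eigenfunction_of_ne h0 hF hm.symm]
  have h3 := h1.unique h2
  rw [coeff, map_sub, inner_sub_right, sub_eq_zero]
  exact h3

end IsEigenSequence
end SturmLiouville

/-! ### Uniqueness of classical solutions. -/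

namespace SturmLiouville

open Topology

variable {S : SturmLiouville} {u y g v w k : ℝ → ℝ}

open Classical in
/-- The restriction of a function to `[0,1]` as a continuous function, with junk value `0`. -/
noncomputable def toCI (f : ℝ → ℝ) : CI :=
  if h : ContinuousOn f (Icc 0 1) then restr f h else 0

theorem toCI_eq {f : ℝ → ℝ} (hf : ContinuousOn f (Icc 0 1)) : toCI f = restr f hf := dif_pos hf

theorem toCI_apply {f : ℝ → ℝ} (hf : ContinuousOn f (Icc 0 1)) (z : Icc (0 : ℝ) 1) :
    toCI f z = f z := by rw [toCI_eq hf, restr_apply]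

theorem continuousOn_section {A : Set ℝ} {F : ℝ × ℝ → ℝ} (hF : ContinuousOn F (A ×ˢ Icc 0 1))
    {t : ℝ} (ht : t ∈ A) : ContinuousOn (fun z => F (t, z)) (Icc 0 1) :=
  hF.comp (by fun_prop) fun _ hz => ⟨ht, hz⟩

theorem continuousOn_toCI {A : Set ℝ} {F : ℝ × ℝ → ℝ} (hF : ContinuousOn F (A ×ˢ Icc 0 1)) :
    ContinuousOn (fun t => toCI fun z => F (t, z)) A := by
  rw [continuousOn_iff_continuous_domRestrict]
  let g : C(A × Icc (0 : ℝ) 1, ℝ) := ⟨fun a => F (a.1, a.2),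
    hF.comp_continuous (by fun_prop) fun a => ⟨a.1.2, a.2.2⟩⟩
  refine (g.curry.continuous).congr fun t => ContinuousMap.ext fun z => ?_
  exact (toCI_apply (continuousOn_section hF t.2) z).symm

theorem eq_of_eqOn_Ioo {f g : CI} (h : EqOn (ext f) (ext g) (Ioo 0 1)) : f = g := by
  have := h.closure (continuous_ext f) (continuous_ext g)
  rw [closure_Ioo zero_ne_one] at this
  exact ContinuousMap.ext fun z => by rw [← ext_coe, this z.2, ext_coe]

/-- A curve of continuous functions is differentiable if it is so pointwise, with a continuous
derivative. -/
theorem hasDerivAt_of_pointwise {V W : ℝ → CI} {s : ℝ} (hW : ContinuousAt W s)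
    (h : ∀ᶠ τ in 𝓝 s, ∀ z, HasDerivAt (fun τ => V τ z) (W τ z) τ) : HasDerivAt V (W s) s := by
  rw [hasDerivAt_iff_isLittleO, Asymptotics.isLittleO_iff]
  intro ε hε
  obtain ⟨δ, hδ, hδ'⟩ := Metric.eventually_nhds_iff_ball.1
    (h.and (Metric.tendsto_nhds.1 hW ε hε))
  filter_upwards [Metric.ball_mem_nhds s hδ] with t ht
  rw [ContinuousMap.norm_le _ (by positivity)]
  intro z
  -- Mean value inequality for τ ↦ V τ z - τ W s z, on a ball that does not depend on z.
  have hd : ∀ τ ∈ Metric.ball s δ, HasDerivWithinAt (fun τ => V τ z - τ * W s z)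
      (W τ z - W s z) (Metric.ball s δ) τ := fun τ hτ =>
    (((hδ' τ hτ).1 z).sub ((hasDerivAt_id τ).mul_const (W s z))).hasDerivWithinAt.congr_deriv
      (by simp)
  have hb : ∀ τ ∈ Metric.ball s δ, ‖W τ z - W s z‖ ≤ ε := fun τ hτ => by
    rw [← dist_eq_norm]
    exact (ContinuousMap.dist_apply_le_dist z).trans (hδ' τ hτ).2.le
  have := (convex_ball s δ).norm_image_sub_le_of_norm_hasDerivWithin_le hd hb
    (Metric.mem_ball_self hδ) ht
  refine le_of_eq_of_le (congrArg norm ?_) this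
  change V t z - V s z - (t - s) * W s z = _
  ring

/-- Lines of constant z stay inside the strip even for z = 0 and z = 1, so the derivative within the
strip in direction `(1, 0)` is a true time derivative, continuous up to the end points. -/
theorem IsClassicalSolution.exists_timeDeriv {d x₀ : ℝ → ℝ} {x : ℝ → ℝ → ℝ}
    (hx : S.IsClassicalSolution d x₀ x) : ∃ F : ℝ × ℝ → ℝ, ContinuousOn F (Ioi 0 ×ˢ Icc 0 1) ∧
      ∀ t, 0 < t → ∀ z ∈ Icc (0 : ℝ) 1, HasDerivAt (fun s => x s z) (F (t, z)) t := by
  set A : Set (ℝ × ℝ) := Ioi 0 ×ˢ Icc 0 1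
  set f : ℝ × ℝ → ℝ := fun tz => x tz.1 tz.2
  have hA : UniqueDiffOn ℝ A := (uniqueDiffOn_Ioi 0).prod uniqueDiffOn_unit
  refine ⟨fun a => fderivWithin ℝ f A a (1, 0),
    (hx.contDiffOn.continuousOn_fderivWithin hA le_rfl).clm_apply continuousOn_const,
    fun t ht z hz => ?_⟩
  have h1 : HasFDerivWithinAt f (fderivWithin ℝ f A (t, z)) A (t, z) :=
    (hx.contDiffOn.differentiableOn one_ne_zero (t, z) ⟨ht, hz⟩).hasFDerivWithinAt
  have h2 : HasDerivWithinAt (fun s : ℝ => (s, z)) (1, 0) (Ioi 0) t :=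
    ((hasDerivAt_id t).prodMk (hasDerivAt_const t z)).hasDerivWithinAt
  exact (h1.comp_hasDerivWithinAt t h2 fun s hs => show (s, z) ∈ A from ⟨hs, hz⟩).hasDerivAt
    (Ioi_mem_nhds ht)

theorem IsClassicalSolution.sub {d d' x₀ x₀' : ℝ → ℝ} {x x' : ℝ → ℝ → ℝ}
    (hx : S.IsClassicalSolution d x₀ x) (hx' : S.IsClassicalSolution d' x₀' x') :
    S.IsClassicalSolution (fun t => d t - d' t) (fun z => x₀ z - x₀' z)
      (fun t z => x t z - x' t z) := by
  have hs : ∀ t, 0 ≤ t → S.Solves (fun z => x t z - x' t z)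
      (fun z => S.p z * der (x t) z + -1 * (S.p z * der (x' t) z))
      (fun z => S.op (x t) z - S.op (x' t) z) := fun t ht =>
    ((solves_op (hx.mem_X t ht).1).add ((solves_op (hx'.mem_X t ht).1).const_mul (-1))).congr
      (fun z _ => by ring) (fun z _ => by ring)
  refine ⟨hx.continuousOn.sub hx'.continuousOn, hx.contDiffOn.sub hx'.contDiffOn, fun t ht => ?_,
    fun z hz => by rw [hx.initial z hz, hx'.initial z hz], fun t ht z hz => ?_⟩
  · have h0 := p_ne (S := S) zero_mem
    have h1 := p_ne (S := S) one_mem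
    refine (hs t ht).mem_X ((continuousOn_op (hx.mem_X t ht).1).sub
      (continuousOn_op (hx'.mem_X t ht).1)) ?_ ?_
    · field_simp
      linear_combination (hx.mem_X t ht).2.1 - (hx'.mem_X t ht).2.1
    · field_simp
      linear_combination (hx.mem_X t ht).2.2 - (hx'.mem_X t ht).2.2
  · have hz' := Ioo_subset_Icc_self hz
    obtain ⟨F, -, hF⟩ := hx.exists_timeDeriv
    obtain ⟨F', -, hF'⟩ := hx'.exists_timeDeriv
    have e := hx.pde t ht z hz
    have e' := hx'.pde t ht z hz
    rw [(hF t ht z hz').deriv] at e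
    rw [(hF' t ht z hz').deriv] at e'
    have h1 : deriv (fun s => x s z - x' s z) t = F (t, z) - F' (t, z) :=
      ((hF t ht z hz').sub (hF' t ht z hz')).deriv
    rw [h1, (hs t ht.le).op_eq hz']
    linear_combination e - e'

/-- The mean value theorem shows that e^{lt} c(t) is constant; at t = 0 it needs continuity only. -/
theorem eq_zero_of_hasDerivAt_neg_mul {c : ℝ → ℝ} {l : ℝ} (hc : ContinuousOn c (Ici 0))
    (hd : ∀ t, 0 < t → HasDerivAt c (-l * c t) t) (h0 : c 0 = 0) {t : ℝ} (ht : 0 ≤ t) :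
    c t = 0 := by
  rcases ht.eq_or_lt with rfl | ht
  · exact h0
  obtain ⟨s, hs, he⟩ := exists_hasDerivAt_eq_slope (fun s => Real.exp (l * s) * c s) (fun _ => 0) ht
    ((by fun_prop : Continuous fun s : ℝ => Real.exp (l * s)).continuousOn.mul
      (hc.mono Icc_subset_Ici_self))
    (fun s hs => (((((hasDerivAt_id s).const_mul l).exp).mul (hd s hs.1)).congr_deriv
      (by simp; ring)))
  rw [eq_comm, div_eq_zero_iff, or_iff_left (by simpa using ht.ne')] at he
  simpa [h0] using he

theorem IsEigenSequence.classicalSolution_eq_zero {lam : ℕ → ℝ} {phi : ℕ → ℝ → ℝ}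
    {u₁ y₁ u₂ y₂ : ℝ → ℝ} (hE : S.IsEigenSequence lam phi) (h0 : 0 < lam 0)
    (hF : S.IsFundamental u₁ y₁ u₂ y₂) {x : ℝ → ℝ → ℝ}
    (hx : S.IsClassicalSolution (fun _ => 0) (fun _ => 0) x) {t : ℝ} (ht : 0 ≤ t) {z : ℝ}
    (hz : z ∈ Icc (0 : ℝ) 1) : x t z = 0 := by
  obtain ⟨F, hFc, hFd⟩ := hx.exists_timeDeriv
  set V : ℝ → CI := fun t => toCI (x t) with hV
  set W : ℝ → CI := fun t => toCI fun z => F (t, z) with hW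
  have hxc : ∀ t, 0 ≤ t → ContinuousOn (x t) (Icc 0 1) := fun t ht => (hx.mem_X t ht).1.continuousOn
  have hVc : ContinuousOn V (Ici 0) := continuousOn_toCI hx.continuousOn
  have hWc : ContinuousOn W (Ioi 0) := continuousOn_toCI hFc
  have hVd : ∀ t, 0 < t → HasDerivAt V (W t) t := fun t ht => by
    refine hasDerivAt_of_pointwise (hWc.continuousAt (Ioi_mem_nhds ht)) ?_
    filter_upwards [Ioi_mem_nhds ht] with τ hτ z
    rw [hW, toCI_apply (continuousOn_section hFc hτ)]
    refine (hFd τ hτ z z.2).congr_of_eventuallyEq ?_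
    filter_upwards [Ioi_mem_nhds hτ] with s hs
    exact toCI_apply (hxc s (le_of_lt hs)) z
  have hVW : ∀ t, 0 < t → V t = hF.green (-W t) := fun t ht => by
    have hm := hx.mem_X t ht.le
    have h1 := hF.green_eq (hE.not_isEigenvalue_zero h0) (solves_op hm.1) (continuousOn_op hm.1)
      (BC_flux hm)
    rw [hV]
    simp only
    rw [toCI_eq (hxc t ht.le), ← h1]
    congr 1
    -- The equation is given only for 0 < z < 1; both sides are continuous on `[0,1]`.
    refine eq_of_eqOn_Ioo fun z hz => ?_
    have hz' := Ioo_subset_Icc_self hz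
    have e := hx.pde t ht z hz
    rw [(hFd t ht z hz').deriv] at e
    rw [ext_restr _ hz', ext_apply _ hz', ContinuousMap.neg_apply,
      toCI_apply (continuousOn_section hFc ht)]
    simp only
    linarith
  suffices hVt : V t = 0 by
    have := congrArg (fun f : CI => f ⟨z, hz⟩) hVt
    simpa [hV, toCI_apply (hxc t ht)] using this
  refine hE.eq_zero_of_coeff_eq_zero hF fun n => ?_
  have hl := (hE.pos h0 n).ne'
  refine eq_zero_of_hasDerivAt_neg_mul (c := fun t => hE.coeff (V t) n) (l := lam n) ?_
    (fun s hs => ?_) ?_ ht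
  · exact (((innerSL ℝ (S.toL2 (hE.eigenfunction n))).comp S.toL2).continuous.comp_continuousOn hVc)
  · have h1 := ((innerSL ℝ (S.toL2 (hE.eigenfunction n))).comp S.toL2).hasFDerivAt.comp_hasDerivAt
      s (hVd s hs)
    refine h1.congr_deriv ?_
    rw [hVW s hs, hE.coeff_green h0 hF, neg_mul, ← mul_assoc, mul_inv_cancel₀ hl, one_mul]
    simp [IsEigenSequence.coeff]
  · have : V 0 = 0 := by
      ext z
      rw [hV, toCI_apply (hxc 0 le_rfl)]
      exact hx.initial z z.2
    simp [IsEigenSequence.coeff, this]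

end SturmLiouville

/-! ### The Cauchy problem with homogeneous boundary conditions. -/

namespace SturmLiouville

open Topology

variable {S : SturmLiouville} {u y g v w k : ℝ → ℝ}

/-- The solution of `a' = -l a + γ e` with initial value `c`. -/
noncomputable def duhamel (l c γ : ℝ) (e : ℝ → ℝ) (t : ℝ) : ℝ :=
  Real.exp (-(l * t)) * (c + γ * ∫ s in (0 : ℝ)..t, Real.exp (l * s) * e s)

theorem duhamel_zero (l c γ : ℝ) (e : ℝ → ℝ) : duhamel l c γ e 0 = c := by simp [duhamel]

theorem hasDerivAt_duhamel (l c γ : ℝ) {e : ℝ → ℝ} (he : Continuous e) (t : ℝ) :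
    HasDerivAt (duhamel l c γ e) (-(l * duhamel l c γ e t) + γ * e t) t := by
  have h1 : HasDerivAt (fun t => ∫ s in (0 : ℝ)..t, Real.exp (l * s) * e s)
      (Real.exp (l * t) * e t) t :=
    ((by fun_prop : Continuous fun s => Real.exp (l * s) * e s).integral_hasStrictDerivAt
      0 t).hasDerivAt
  have h2 : HasDerivAt (fun t => Real.exp (-(l * t))) (Real.exp (-(l * t)) * (-l)) t := by
    simpa using (((hasDerivAt_id t).const_mul l).neg).exp
  refine (h2.mul ((h1.const_mul γ).const_add c)).congr_deriv ?_
  have h3 : Real.exp (-(l * t)) * Real.exp (l * t) = 1 := by rw [← Real.exp_add]; simp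
  rw [duhamel]
  linear_combination γ * e t * h3

/-- Integrating e^{ls} gains a factor 1/l, which absorbs the l on the left in the forcing term; the
initial term keeps its l, to be paid for by decay of c or by the exponential. -/
theorem mul_abs_duhamel_le {l c γ E t : ℝ} {e : ℝ → ℝ} (hl : 0 < l)
    (ht : 0 ≤ t) (hE : ∀ s ∈ Icc 0 t, |e s| ≤ E) :
    l * |duhamel l c γ e t| ≤ l * Real.exp (-(l * t)) * |c| + |γ| * E := by
  have hE0 : 0 ≤ E := (abs_nonneg _).trans (hE 0 ⟨le_rfl, ht⟩)
  have h1 : |∫ s in (0 : ℝ)..t, Real.exp (l * s) * e s| ≤ Real.exp (l * t) / l * E := by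
    calc |∫ s in (0 : ℝ)..t, Real.exp (l * s) * e s|
        ≤ ∫ s in (0 : ℝ)..t, Real.exp (l * s) * E := by
          rw [← Real.norm_eq_abs]
          refine intervalIntegral.norm_integral_le_of_norm_le ht
            (Filter.Eventually.of_forall fun s hs => ?_)
            ((by fun_prop : Continuous fun s => Real.exp (l * s) * E).intervalIntegrable _ _)
          rw [norm_mul, Real.norm_of_nonneg (Real.exp_pos _).le]
          gcongr
          exact hE s (Ioc_subset_Icc_self hs)
      _ ≤ _ := by
          rw [intervalIntegral.integral_mul_const,
            intervalIntegral.integral_comp_mul_left _ hl.ne', integral_exp, smul_eq_mul, mul_zero,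
            Real.exp_zero, div_eq_inv_mul]
          gcongr
          linarith
  have h3 : Real.exp (-(l * t)) * Real.exp (l * t) = 1 := by rw [← Real.exp_add]; simp
  rw [duhamel, abs_mul, abs_of_pos (Real.exp_pos _)]
  calc l * (Real.exp (-(l * t)) * |c + γ * ∫ s in (0 : ℝ)..t, Real.exp (l * s) * e s|)
      ≤ l * (Real.exp (-(l * t)) * (|c| + |γ| * (Real.exp (l * t) / l * E))) := by
        gcongr
        refine (abs_add_le _ _).trans ?_
        rw [abs_mul]
        gcongr
    _ = l * Real.exp (-(l * t)) * |c| + |γ| * E * (Real.exp (-(l * t)) * Real.exp (l * t)) := by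
        field_simp
    _ = _ := by rw [h3, mul_one]

theorem mul_exp_neg_le_inv {l ε t : ℝ} (hl : 0 < l) (hε : 0 < ε) (ht : ε ≤ t) :
    l * Real.exp (-(l * t)) ≤ ε⁻¹ := by
  rw [Real.exp_neg, ← div_eq_mul_inv, div_le_iff₀ (Real.exp_pos _), inv_mul_eq_div, le_div_iff₀ hε]
  calc l * ε ≤ l * t := by gcongr
    _ ≤ Real.exp (l * t) := by linarith [Real.add_one_le_exp (l * t)]

/-- Solution of the abstract Cauchy problem `w' + A w = e(t) G h`, `w(0) = G f` by expansion in
eigenfunctions; `U = A w`. -/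
theorem IsEigenSequence.exists_mildSolution {lam : ℕ → ℝ} {phi : ℕ → ℝ → ℝ}
    {u₁ y₁ u₂ y₂ : ℝ → ℝ} (hE : S.IsEigenSequence lam phi) (h0 : 0 < lam 0)
    (hF : S.IsFundamental u₁ y₁ u₂ y₂)
    (hs : Summable fun n => (lam n)⁻¹ * ‖hE.eigenfunction n‖) (f h : CI) {e : ℝ → ℝ}
    (he : Continuous e) :
    ∃ w U : ℝ → CI, ContinuousOn w (Ici 0) ∧ w 0 = hF.green f ∧ ContinuousOn U (Ioi 0) ∧
      ∀ t, 0 < t → w t = hF.green (U t) ∧ HasDerivAt w (-U t + e t • hF.green h) t := by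
  have hpos := hE.pos h0
  set c : ℕ → ℝ := hE.coeff (hF.green f)
  set γ : ℕ → ℝ := hE.coeff (hF.green h)
  have hc : ∀ n, |c n| ≤ (lam n)⁻¹ * ‖S.toL2 f‖ := fun n => by
    rw [show c n = hE.coeff (hF.green f) n from rfl, hE.coeff_green h0, abs_mul,
      abs_of_pos (inv_pos.2 (hpos n))]
    have := inv_pos.2 (hpos n)
    gcongr
    exact hE.abs_coeff_le f n
  have hγ : ∀ n, |γ n| ≤ (lam n)⁻¹ * ‖S.toL2 h‖ := fun n => by
    rw [show γ n = hE.coeff (hF.green h) n from rfl, hE.coeff_green h0, abs_mul,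
      abs_of_pos (inv_pos.2 (hpos n))]
    have := inv_pos.2 (hpos n)
    gcongr
    exact hE.abs_coeff_le h n
  set a : ℕ → ℝ → ℝ := fun n => duhamel (lam n) (c n) (γ n) e
  have had : ∀ n t, HasDerivAt (a n) (-(lam n * a n t) + γ n * e t) t := fun n t =>
    hasDerivAt_duhamel _ _ _ he t
  have hac : ∀ n, Continuous (a n) := fun n =>
    continuous_iff_continuousAt.2 fun t => (had n t).continuousAt
  have hEb : ∀ T : ℝ, ∃ E, 0 ≤ E ∧ ∀ s ∈ Icc 0 T, |e s| ≤ E := fun T => by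
    obtain ⟨E, hE⟩ := isCompact_Icc.exists_bound_of_continuousOn (he.continuousOn (s := Icc 0 T))
    exact ⟨max E 0, le_max_right _ _, fun s hs => (hE s hs).trans (le_max_left _ _)⟩
  have hsm : ∀ (b : ℕ → ℝ) (C : ℝ), (∀ n, |b n| ≤ C * (lam n)⁻¹) →
      ∀ n, ‖b n • hE.eigenfunction n‖ ≤ C * ((lam n)⁻¹ * ‖hE.eigenfunction n‖) := by
    intro b C hb n
    rw [norm_smul, Real.norm_eq_abs, ← mul_assoc]
    gcongr
    exact hb n
  -- Up to t = 0 the exponential is only bounded by 1, and the decay comes from λ_n |c_n| ≤ ‖f‖.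
  have bound_zero : ∀ T : ℝ, ∃ C, ∀ n, ∀ t ∈ Icc 0 T, |a n t| ≤ C * (lam n)⁻¹ := fun T => by
    obtain ⟨E, hE0, hEE⟩ := hEb T
    refine ⟨‖S.toL2 f‖ + (lam 0)⁻¹ * ‖S.toL2 h‖ * E, fun n t ht => ?_⟩
    have hl := hpos n
    have h1 := mul_abs_duhamel_le (c := c n) (γ := γ n) hl ht.1
      fun s hs => hEE s ⟨hs.1, hs.2.trans ht.2⟩
    have h2 : (lam n)⁻¹ ≤ (lam 0)⁻¹ := by
      gcongr
      exact hE.strictMono.monotone n.zero_le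
    rw [← div_eq_mul_inv, le_div_iff₀ hl, mul_comm]
    refine h1.trans ?_
    have h3 : Real.exp (-(lam n * t)) ≤ 1 := by
      rw [Real.exp_le_one_iff]
      have := ht.1
      simp only [Left.neg_nonpos_iff]
      positivity
    have h4 : lam n * |c n| ≤ ‖S.toL2 f‖ := by
      calc lam n * |c n| ≤ lam n * ((lam n)⁻¹ * ‖S.toL2 f‖) := by gcongr; exact hc n
        _ = _ := by field_simp
    gcongr ?_ + ?_ * E
    · calc lam n * Real.exp (-(lam n * t)) * |c n|
          = Real.exp (-(lam n * t)) * (lam n * |c n|) := by ring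
        _ ≤ 1 * (lam n * |c n|) := by gcongr
        _ ≤ _ := by rwa [one_mul]
    · refine (hγ n).trans ?_
      gcongr
  -- For t ≥ ε the bound λ_n e^{-λ_n t} ≤ 1/ε leaves the decay of c_n available, so one more power
  -- of λ_n is affordable.
  have bound_pos : ∀ ε T : ℝ, 0 < ε → ∃ C, ∀ n, ∀ t ∈ Icc ε T,
      |lam n * a n t| ≤ C * (lam n)⁻¹ ∧ |-(lam n * a n t) + γ n * e t| ≤ C * (lam n)⁻¹ :=
    fun ε T hε => by
    obtain ⟨E, hE0, hEE⟩ := hEb T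
    refine ⟨ε⁻¹ * ‖S.toL2 f‖ + ‖S.toL2 h‖ * E + ‖S.toL2 h‖ * E, fun n t ht => ?_⟩
    have hl := hpos n
    have ht0 : 0 ≤ t := hε.le.trans ht.1
    have h1 := mul_abs_duhamel_le (c := c n) (γ := γ n) hl ht0
      fun s hs => hEE s ⟨hs.1, hs.2.trans ht.2⟩
    have h2 := mul_exp_neg_le_inv hl hε ht.1
    have h3 : |γ n| * E ≤ ‖S.toL2 h‖ * E * (lam n)⁻¹ := by
      calc |γ n| * E ≤ (lam n)⁻¹ * ‖S.toL2 h‖ * E := by gcongr; exact hγ n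
        _ = _ := by ring
    have h4 : |lam n * a n t| ≤ (ε⁻¹ * ‖S.toL2 f‖ + ‖S.toL2 h‖ * E) * (lam n)⁻¹ := by
      rw [abs_mul, abs_of_pos hl]
      refine h1.trans ?_
      calc _ ≤ ε⁻¹ * ((lam n)⁻¹ * ‖S.toL2 f‖) + ‖S.toL2 h‖ * E * (lam n)⁻¹ := by
            gcongr
            exact hc n
        _ = _ := by ring
    have h5 : 0 ≤ ‖S.toL2 h‖ * E * (lam n)⁻¹ := by positivity
    refine ⟨h4.trans (by linarith), (abs_add_le _ _).trans ?_⟩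
    rw [abs_neg, abs_mul (γ n)]
    have h6 : |γ n| * |e t| ≤ |γ n| * E := by gcongr; exact hEE t ⟨ht0, ht.2⟩
    linarith
  set w : ℝ → CI := fun t => ∑' n, a n t • hE.eigenfunction n with hw
  set U : ℝ → CI := fun t => ∑' n, (lam n * a n t) • hE.eigenfunction n
  have hsumw : ∀ t, 0 ≤ t → Summable fun n => a n t • hE.eigenfunction n := fun t ht => by
    obtain ⟨C, hC⟩ := bound_zero t
    exact Summable.of_norm_bounded (hs.mul_left C) (hsm _ C fun n => hC n t ⟨ht, le_rfl⟩)
  have hsumU : ∀ t, 0 < t → Summable fun n => (lam n * a n t) • hE.eigenfunction n :=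
    fun t ht => by
    obtain ⟨C, hC⟩ := bound_pos t t ht
    exact Summable.of_norm_bounded (hs.mul_left C) (hsm _ C fun n => (hC n t ⟨le_rfl, le_rfl⟩).1)
  refine ⟨w, U, fun t ht => ?_, ?_, fun t ht => ?_, fun t ht => ⟨?_, ?_⟩⟩
  · obtain ⟨C, hC⟩ := bound_zero (t + 1)
    have hcont : ContinuousOn w (Icc 0 (t + 1)) :=
      continuousOn_tsum (fun n => ((hac n).smul continuous_const).continuousOn) (hs.mul_left C)
        fun n s hs => hsm (fun n => a n s) C (fun n => hC n s hs) n
    exact (hcont t ⟨ht, by linarith⟩).mono_of_mem_nhdsWithin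
      (Filter.mem_of_superset (inter_mem_nhdsWithin _ (Iic_mem_nhds (lt_add_one t)))
        fun s hs => ⟨hs.1, hs.2⟩)
  · rw [hw]
    simp only [a, duhamel_zero]
    exact (hE.hasSum_coeff h0 hF hs f).tsum_eq
  · obtain ⟨C, hC⟩ := bound_pos (t / 2) (t + 1) (half_pos ht)
    have hcont : ContinuousOn U (Icc (t / 2) (t + 1)) :=
      continuousOn_tsum (fun n => ((continuous_const.mul (hac n)).smul
        continuous_const).continuousOn) (hs.mul_left C)
        fun n s hs => hsm (fun n => lam n * a n s) C (fun n => (hC n s hs).1) n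
    exact (hcont.continuousAt (Icc_mem_nhds (half_lt_self ht) (lt_add_one t))).continuousWithinAt
  -- G is continuous and divides the n-th term by λ_n, so it maps the series of U to that of w.
  · have h1 := (hsumU t ht).hasSum.mapL hF.green
    have h2 := (hsumw t ht.le).hasSum
    refine h2.unique ?_
    refine h1.congr_fun fun n => ?_
    rw [map_smul, hE.green_eigenfunction h0, smul_smul, mul_comm, inv_mul_cancel_left₀ (hpos n).ne']
  · obtain ⟨C, hC⟩ := bound_pos (t / 2) (t + 1) (half_pos ht)
    have hmem : t ∈ Ioo (t / 2) (t + 1) := ⟨half_lt_self ht, lt_add_one t⟩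
    have hd := hasDerivAt_tsum_of_isPreconnected (hs.mul_left C) isOpen_Ioo isPreconnected_Ioo
      (g := fun n t => a n t • hE.eigenfunction n)
      (g' := fun n t => (-(lam n * a n t) + γ n * e t) • hE.eigenfunction n)
      (fun n s _ => (had n s).smul_const (hE.eigenfunction n))
      (fun n s hs => hsm (fun n => -(lam n * a n s) + γ n * e s) C
        (fun n => (hC n s (Ioo_subset_Icc_self hs)).2) n) hmem (hsumw t ht.le) hmem
    refine hd.congr_deriv (HasSum.tsum_eq ?_)
    have h3 := (hsumU t ht).hasSum.neg.add ((hE.hasSum_coeff h0 hF hs h).const_smul (e t))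
    refine h3.congr_fun fun n => ?_
    rw [add_smul, neg_smul, smul_smul, mul_comm (γ n)]

theorem continuousOn_ext_curve {A : Set ℝ} {W : ℝ → CI} (hW : ContinuousOn W A) :
    ContinuousOn (fun a : ℝ × ℝ => ext (W a.1) a.2) (A ×ˢ Icc 0 1) :=
  (hW.comp continuousOn_fst fun _ ha => ha.1).eval
    ((continuous_projIcc.comp continuous_snd).continuousOn)

/-- Joint continuous differentiability of a differentiable curve of differentiable functions. -/
theorem contDiffOn_of_curve {V V' Y : ℝ → CI} (hV : ∀ t, 0 < t → HasDerivAt V (V' t) t)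
    (hV' : ContinuousOn V' (Ioi 0)) (hY : ContinuousOn Y (Ioi 0))
    (hz : ∀ t, 0 < t → ∀ z ∈ Icc (0 : ℝ) 1,
      HasDerivWithinAt (ext (V t)) (ext (Y t) z) (Icc 0 1) z) :
    ContDiffOn ℝ 1 (fun a : ℝ × ℝ => ext (V a.1) a.2) (Ioi 0 ×ˢ Icc 0 1) := by
  rw [show (1 : WithTop ℕ∞) = 0 + 1 by norm_num,
    contDiffOn_succ_iff_hasFDerivWithinAt_of_uniqueDiffOn
    ((uniqueDiffOn_Ioi 0).prod uniqueDiffOn_unit)]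
  refine ⟨by simp, fun a => ext (V' a.1) a.2 • ContinuousLinearMap.fst ℝ ℝ ℝ
    + ext (Y a.1) a.2 • ContinuousLinearMap.snd ℝ ℝ ℝ,
    contDiffOn_zero.2 (((continuousOn_ext_curve hV').smul continuousOn_const).add
      ((continuousOn_ext_curve hY).smul continuousOn_const)),
    ?_⟩
  rintro ⟨t₀, z₀⟩ ⟨ht₀, hz₀⟩
  set A : Set (ℝ × ℝ) := Ioi 0 ×ˢ Icc 0 1
  have hfst : (fun a : ℝ × ℝ => a.1 - t₀) =O[𝓝[A] (t₀, z₀)] fun a => a - (t₀, z₀) :=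
    Asymptotics.isBigO_of_le _ fun a => norm_fst_le (a - (t₀, z₀))
  -- V(t)(z) is split into the Taylor remainder in t, which is o(t - t₀) uniformly in z, the linear
  -- term (t - t₀) V'(t₀)(z), and V(t₀)(z).
  have h1 : HasFDerivWithinAt (fun a : ℝ × ℝ => ext (V a.1 - V t₀ - (a.1 - t₀) • V' t₀) a.2)
      (0 : ℝ × ℝ →L[ℝ] ℝ) A (t₀, z₀) := by
    refine HasFDerivWithinAt.of_isLittleO ?_
    have hlo := (hasDerivAt_iff_isLittleO.1 (hV t₀ ht₀)).comp_tendsto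
      ((continuous_fst.tendsto (t₀, z₀)).mono_left (nhdsWithin_le_nhds (s := A)))
    refine (Asymptotics.IsBigO.trans_isLittleO (Asymptotics.isBigO_of_le _ fun a => ?_)
      hlo).trans_isBigO hfst
    have h0 : ext (V t₀ - V t₀ - (t₀ - t₀) • V' t₀) z₀ = 0 := by
      rw [sub_self, sub_self, zero_smul, sub_zero]
      rfl
    simp only [h0, zero_apply, sub_zero, Real.norm_eq_abs]
    exact abs_ext_le _ _
  have h2 : HasFDerivWithinAt (fun a : ℝ × ℝ => (a.1 - t₀) * ext (V' t₀) a.2)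
      (ext (V' t₀) z₀ • ContinuousLinearMap.fst ℝ ℝ ℝ) A (t₀, z₀) := by
    refine HasFDerivWithinAt.of_isLittleO ?_
    have hc : (fun a : ℝ × ℝ => ext (V' t₀) a.2 - ext (V' t₀) z₀)
        =o[𝓝[A] (t₀, z₀)] fun _ => (1 : ℝ) := by
      rw [Asymptotics.isLittleO_one_iff]
      have := ((continuous_ext (V' t₀)).comp continuous_snd).tendsto (t₀, z₀)
      simpa using (this.sub_const (ext (V' t₀) z₀)).mono_left (nhdsWithin_le_nhds (s := A))
    have hg : (fun a : ℝ × ℝ => a - (t₀, z₀)) =O[𝓝[A] (t₀, z₀)] fun a => ‖a - (t₀, z₀)‖ :=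
      (Asymptotics.isBigO_refl _ _).norm_right
    refine Asymptotics.IsLittleO.of_norm_right ?_
    refine ((hfst.trans hg).mul_isLittleO hc).congr (fun a => ?_) fun a => mul_one _
    simp
    ring
  have h3 : HasFDerivWithinAt (fun a : ℝ × ℝ => ext (V t₀) a.2)
      (ext (Y t₀) z₀ • ContinuousLinearMap.snd ℝ ℝ ℝ) A (t₀, z₀) :=
    (hz t₀ ht₀ z₀ hz₀).comp_hasFDerivWithinAt (t₀, z₀) hasFDerivWithinAt_snd fun a ha => ha.2
  refine ((h1.add h2).add h3).congr_fderiv (by simp) |>.congr (fun a _ => ?_) ?_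
  · change ext (V a.1) a.2 = (ext (V a.1) a.2 - ext (V t₀) a.2 - (a.1 - t₀) * ext (V' t₀) a.2)
      + (a.1 - t₀) * ext (V' t₀) a.2 + ext (V t₀) a.2
    ring
  · change ext (V t₀) z₀ = (ext (V t₀) z₀ - ext (V t₀) z₀ - (t₀ - t₀) * ext (V' t₀) z₀)
      + (t₀ - t₀) * ext (V' t₀) z₀ + ext (V t₀) z₀
    ring

end SturmLiouville

/-! ### Lifting the boundary disturbance; existence of a classical solution. -/

namespace SturmLiouville

variable {S : SturmLiouville}

/-- Existence of a classical solution. -/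
theorem IsEigenSequence.exists_isClassicalSolution {lam : ℕ → ℝ} {phi : ℕ → ℝ → ℝ}
    {u₁ y₁ u₂ y₂ : ℝ → ℝ} (hE : S.IsEigenSequence lam phi) (h0 : 0 < lam 0)
    (hF : S.IsFundamental u₁ y₁ u₂ y₂)
    (hs : Summable fun n => (lam n)⁻¹ * ‖hE.eigenfunction n‖) {d x₀ : ℝ → ℝ}
    (hd : ContDiffOn ℝ 2 d (Ici 0)) (hx₀ : x₀ ∈ S.X (d 0)) :
    ∃ x, S.IsClassicalSolution d x₀ x := by
  have hu : UniqueDiffOn ℝ (Ici (0 : ℝ)) := uniqueDiffOn_Ici 0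
  have hev := hE.not_isEigenvalue_zero h0
  set d₁ := derivWithin d (Ici 0)
  set d₂ := derivWithin d₁ (Ici 0)
  have hd₁c : ContDiffOn ℝ 1 d₁ (Ici 0) := hd.derivWithin hu (by norm_num)
  have hd₂c : ContinuousOn d₂ (Ici 0) := ((contDiffOn_one_iff_derivWithin hu).1 hd₁c).2
  have hdd : ∀ t, 0 < t → HasDerivAt d (d₁ t) t := fun t ht =>
    ((hd.differentiableOn two_ne_zero t ht.le).hasDerivWithinAt).hasDerivAt (Ici_mem_nhds ht)
  have hdd₁ : ∀ t, 0 < t → HasDerivAt d₁ (d₂ t) t := fun t ht =>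
    ((hd₁c.differentiableOn one_ne_zero t ht.le).hasDerivWithinAt).hasDerivAt (Ici_mem_nhds ht)
  set β := S.b₁ * u₂ 0 + S.b₂ * (y₂ 0 / S.p 0) with hβ
  have hβ0 : β ≠ 0 := hF.ne
  have hH := hF.solves₂.const_mul β⁻¹
  simp only [mul_zero] at hH
  set η : ℝ → ℝ := fun z => β⁻¹ * y₂ z with hη
  set H : CI := restr _ hH.continuousOn with hHdef
  have hHη : S.Solves (ext H) η fun _ => 0 :=
    hH.congr (fun z hz => ext_restr _ hz) fun _ _ => rfl
  have hH0 : S.b₁ * ext H 0 + S.b₂ * (η 0 / S.p 0) = 1 := by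
    rw [hHdef, ext_restr _ zero_mem]
    simp only [hη]
    field_simp
    rw [hβ]
    field_simp [p_ne (S := S) zero_mem]
  have hH1 : S.a₁ * ext H 1 + S.a₂ * (η 1 / S.p 1) = 0 := by
    rw [hHdef, ext_restr _ one_mem]
    simp only [hη]
    linear_combination β⁻¹ * hF.bc₂
  have hp0 := p_ne (S := S) zero_mem
  have hp1 := p_ne (S := S) one_mem
  have hopc : ContinuousOn (S.op x₀) (Icc 0 1) := continuousOn_op hx₀.1
  have hx₀c := hx₀.1.continuousOn
  -- Subtracting d(0) H makes the boundary conditions homogeneous without changing A x₀.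
  have hinit : restr x₀ hx₀c - d 0 • H = hF.green (restr _ hopc) := by
    have hsol := ((solves_op hx₀.1).add (hHη.const_mul (-d 0))).congr (k := S.op x₀)
      (fun _ _ => rfl) fun z _ => by ring
    have hb : S.BC (fun z => x₀ z + -d 0 * ext H z)
        (fun z => S.p z * der x₀ z + -d 0 * η z) := by
      constructor
      · field_simp at hH0 ⊢
        linear_combination S.p 0 * hx₀.2.1 - d 0 * hH0
      · field_simp at hH1 ⊢
        linear_combination S.p 1 * hx₀.2.2 - d 0 * hH1
    rw [hF.green_eq hev hsol hopc hb]
    ext z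
    change x₀ z - d 0 * H z = x₀ z + -d 0 * ext H z
    rw [ext_coe]
    ring
  -- The summand d'(0) H in the initial datum compensates -d' G H in the ansatz at t = 0. Clamping t
  -- at 0 makes the forcing continuous on the whole line and changes nothing for t ≥ 0.
  obtain ⟨w, U, hwc, hw0, hUc, hw⟩ := hE.exists_mildSolution h0 hF hs
    (restr _ hopc + d₁ 0 • H) H (e := fun t => d₂ (max t 0))
    (hd₂c.comp_continuous (by fun_prop) fun t => mem_Ici.2 (le_max_right _ _))
  set V : ℝ → CI := fun t => d t • H + w t - d₁ t • hF.green H with hV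
  have hVc : ContinuousOn V (Ici 0) :=
    ((hd.continuousOn.smul continuousOn_const).add hwc).sub
      (hd₁c.continuousOn.smul continuousOn_const)
  have hV0 : V 0 = restr x₀ hx₀c := by
    rw [hV]
    simp only
    rw [hw0, map_add, map_smul, ← hinit]
    abel
  have hVd : ∀ t, 0 < t → HasDerivAt V (d₁ t • H - U t) t := fun t ht => by
    refine ((((hdd t ht).smul_const H).add (hw t ht).2).sub
      ((hdd₁ t ht).smul_const (hF.green H))).congr_deriv ?_
    rw [max_eq_left ht.le]
    abel
  -- A V = U - d' H is exactly minus the time derivative of V, which is the differential equation.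
  have hsol : ∀ t, 0 < t → S.Solves (ext (V t))
      (fun z => d t * η z + (ext (hF.greenFlux (U t)) z + -d₁ t * ext (hF.greenFlux H) z))
      (fun z => ext (U t) z - d₁ t * ext H z) := fun t ht => by
    refine ((hHη.const_mul (d t)).add ((hF.solves_green (U t)).add
      ((hF.solves_green H).const_mul (-d₁ t)))).congr (fun z _ => ?_) fun z _ => by ring
    rw [← (hw t ht).1]
    change d t * ext H z + ext (w t) z - d₁ t * ext (hF.green H) z = _
    ring
  refine ⟨fun t => ext (V t), continuousOn_ext_curve hVc, ?_, fun t ht => ?_, fun z hz => ?_,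
    fun t ht z hz => ?_⟩
  · have hηc : ContinuousOn η (Icc 0 1) := hHη.continuousOn_flux
    refine contDiffOn_of_curve (Y := fun t => restr _ (continuousOn_inv_p (S := S)) *
      (d t • restr η hηc + (hF.greenFlux (U t) - d₁ t • hF.greenFlux H))) hVd ?_ ?_ ?_
    · exact ((hd₁c.continuousOn.mono Ioi_subset_Ici_self).smul continuousOn_const).sub hUc
    · exact continuousOn_const.mul (((hd.continuousOn.mono Ioi_subset_Ici_self).smul
        continuousOn_const).add ((hF.greenFlux.continuous.comp_continuousOn hUc).sub
        ((hd₁c.continuousOn.mono Ioi_subset_Ici_self).smul continuousOn_const)))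
    · intro t ht z hz
      refine (hsol t ht z hz).1.congr_deriv ?_
      simp only [ext_apply _ hz]
      change _ = (S.p z)⁻¹ * (d t * η z + (hF.greenFlux (U t) ⟨z, hz⟩
        - d₁ t * hF.greenFlux H ⟨z, hz⟩))
      ring
  -- At t = 0 the representation w = G U is not available; membership is that of x₀ itself.
  · rcases ht.eq_or_lt with rfl | ht
    · refine X_congr (fun z hz => ?_) hx₀
      rw [hV0, ext_restr _ hz]
    · have hU := hF.BC_green (U t)
      have hG := hF.BC_green H
      have e : ∀ z, ext (V t) z = d t * ext H z + ext (hF.green (U t)) z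
          - d₁ t * ext (hF.green H) z := fun z => by
        rw [← (hw t ht).1]
        rfl
      refine (hsol t ht).mem_X ((continuous_ext _).sub
        (continuous_const.mul (continuous_ext _))).continuousOn ?_ ?_
      · rw [e]
        linear_combination d t * hH0 + hU.1 - d₁ t * hG.1
      · rw [e]
        linear_combination d t * hH1 + hU.2 - d₁ t * hG.2
  · rw [hV0, ext_restr _ hz]
  · have hz' := Ioo_subset_Icc_self hz
    rw [(hsol t ht).op_eq hz']
    have h1 := (ContinuousMap.evalCLM ℝ (⟨z, hz'⟩ : Icc (0 : ℝ) 1)).hasFDerivAt.comp_hasDerivAt t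
      (hVd t ht)
    have h2 : deriv (fun s => ext (V s) z) t = (d₁ t • H - U t) ⟨z, hz'⟩ := by
      refine Eq.trans ?_ h1.deriv
      congr 1
      funext s
      exact ext_apply _ hz'
    rw [h2, ext_apply _ hz', ext_apply _ hz']
    change d₁ t * H ⟨z, hz'⟩ - U t ⟨z, hz'⟩ + _ = 0
    ring

end SturmLiouville

theorem corollary3p2 (S : SturmLiouville) (hH : S.AssumptionH) (hb : S.b₁ ^ 2 + S.b₂ ^ 2 = 1)
    (d : ℝ → ℝ) (hd : ContDiffOn ℝ 2 d (Ici 0)) (x₀ : ℝ → ℝ) (hx₀ : x₀ ∈ S.X (d 0)) :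
    ∃ x : ℝ → ℝ → ℝ, S.IsClassicalSolution d x₀ x ∧
      ∀ y : ℝ → ℝ → ℝ, S.IsClassicalSolution d x₀ y →
        ∀ t, 0 ≤ t → ∀ z ∈ Icc (0 : ℝ) 1, y t z = x t z := by
  obtain ⟨lam, phi, hE, h0, hs⟩ := hH
  obtain ⟨u₁, y₁, u₂, y₂, hF⟩ := SturmLiouville.exists_isFundamental (hE.not_isEigenvalue_zero h0)
  obtain ⟨x, hx⟩ := hE.exists_isClassicalSolution h0 hF (hE.summable_norm h0 hs) hd hx₀
  refine ⟨x, hx, fun y hy t ht z hz => sub_eq_zero.1 ?_⟩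
  refine hE.classicalSolution_eq_zero h0 hF (x := fun t z => y t z - x t z) ?_ ht hz
  simpa only [sub_self] using hy.sub hx
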